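/- Let $X$ be a compact Hausdorff space, let $C(X)$ be the C*-algebra of continuous complex-valued functions on $X$, and for $x\in X$ let $C_x(X)=\{f\in C(X): f(x)=0\}$. Let $A$ be a separable unital continuous $C(X)$-algebra, i.e. a separable unital C*-algebra with a unital $*$-homomorphism from $C(X)$ to the centre of $A$ such that for every $a\in A$ the function $x\mapsto\|a_x\|$ is continuous on $X$, where $a_x$ is the image of $a$ in the fibre $A_x=A/C_x(X)A$ with its quotient norm. Let $V\subseteq A$ be a $C(X)$-submodule, not necessarily closed, where $M_n(V)$ carries the norm of $M_n(A)$. For $x\in X$ let $V_x=V/C_x(X)V$ be the fibre of $V$ at $x$, where $C_x(X)V$ is the linear span of the products $fv$ with $f\in C_x(X)$, $v\in V$; let $v_x\in V_x$ be the image of $v\in V$, and let $M_n(V_x)=M_n(V)/M_n(C_x(X)V)$ carry the quotient (semi)norm, for every $n$. Let $x\in X$, let $k,l$ be non-negative integers, and let $\phi:V_x\to M_{k,l}(\mathbb{C})$ be a completely contractive linear map, i.e. for every $n$ the entrywise map $M_n(V_x)\to M_n(M_{k,l}(\mathbb{C}))=M_{nk,nl}(\mathbb{C})$ is contractive. Then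 $\phi$ extends to a $C(X)$-linear completely contractive map on $V$: there is a $C(X)$-linear map $\varphi:V\to M_{k,l}(C(X))$ such that for every $n$ the entrywise map $M_n(V)\to M_n(M_{k,l}(C(X)))=M_{nk,nl}(C(X))$ is contractive, and $\varphi(v)(x)=\phi(v_x)$ for all $v\in V$. -/

import Mathlib

open scoped ComplexOrder

noncomputable section

namespace CXWittstock

variable {X : Type*} [TopologicalSpace X]

/-- The ideal `C_x(X)` of continuous functions on `X` that vanish at the point `x`. -/
def vanishingIdeal (x : X) : Ideal C(X, ℂ) :=
  RingHom.ker (ContinuousMap.evalAlgHom ℂ ℂ x : C(X, ℂ) →ₐ[ℂ] ℂ)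

/-- The fibre `E_x = E / C_x(X) E` of a `C(X)`-module `E`. If `E` is normed, it carries
Mathlib's quotient (semi)norm, `‖e_x‖ = inf {‖e + u‖ : u ∈ C_x(X) E}`. -/
abbrev Fibre (E : Type*) [AddCommGroup E] [Module C(X, ℂ) E] (x : X) : Type _ :=
  E ⧸ (vanishingIdeal x • ⊤ : Submodule C(X, ℂ) E)

/-- The image `e_x` of `e` in the fibre `E_x`. -/
def toFibre {E : Type*} [AddCommGroup E] [Module C(X, ℂ) E] (x : X) (e : E) : Fibre E x :=
  Submodule.Quotient.mk e

/-- A `C(X)`-algebra `A` is continuous if `x ↦ ‖a_x‖` is continuous for every `a ∈ A`. -/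
def IsContinuousField (X : Type*) [TopologicalSpace X] (A : Type*) [CStarAlgebra A]
    [Algebra C(X, ℂ) A] : Prop :=
  ∀ a : A, Continuous fun x : X => ‖toFibre x a‖

/-- The norm of `M_n(V)`, for a `C(X)`-submodule `V` of a C⋆-algebra `A`, inherited from the
C⋆-algebra `M_n(A)`. -/
def subNorm {A : Type*} [CStarAlgebra A] [PartialOrder A] [StarOrderedRing A]
    [Algebra C(X, ℂ) A] (V : Submodule C(X, ℂ) A) (n : ℕ)
    (v : Matrix (Fin n) (Fin n) V) : ℝ :=
  ‖CStarMatrix.ofMatrix (v.map fun a : V => (a : A))‖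

/-- The quotient norm of `M_n(V_x) = M_n(V) / M_n(C_x(X) V)`: the infimum of the norms of the
lifts to `M_n(V)`. -/
def fibreNorm {A : Type*} [CStarAlgebra A] [PartialOrder A] [StarOrderedRing A]
    [Algebra C(X, ℂ) A] (V : Submodule C(X, ℂ) A) (x : X) (n : ℕ)
    (w : Matrix (Fin n) (Fin n) (Fibre V x)) : ℝ :=
  sInf {r : ℝ | ∃ v : Matrix (Fin n) (Fin n) V, v.map (toFibre x) = w ∧ r = subNorm V n v}

/-- The norm of `M_n(M_{k,l}(B)) = M_{nk,nl}(B)` for a C⋆-algebra `B`. -/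
def blockNorm (B : Type*) [CStarAlgebra B] [PartialOrder B] [StarOrderedRing B] (k l n : ℕ)
    (u : Matrix (Fin n) (Fin n) (Matrix (Fin k) (Fin l) B)) : ℝ :=
  ‖CStarMatrix.ofMatrix (Matrix.comp (Fin n) (Fin n) (Fin k) (Fin l) B u)‖

/-- A map `T : E → F` is completely contractive, with respect to the norms `p n` on `M_n(E)` and
`q n` on `M_n(F)`, if each of its entrywise amplifications `M_n(E) → M_n(F)` is contractive. -/
def IsCompletelyContractive {E F : Type*} (p : ∀ n : ℕ, Matrix (Fin n) (Fin n) E → ℝ)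
    (q : ∀ n : ℕ, Matrix (Fin n) (Fin n) F → ℝ) (T : E → F) : Prop :=
  ∀ (n : ℕ) (w : Matrix (Fin n) (Fin n) E), q n (w.map T) ≤ p n w

end CXWittstock

end

open CXWittstock

/-! A linear map from `V` to k × l matrices is the same as a functional on `M_{k,l}(V)`, via `F z =
∑ i, ∑ j, φ (z i j) i j`. It is completely contractive exactly when `F` is dominated by
`traceSeminorm`, whose unit ball consists of the products `ξᴴ w η` with `w` a contraction over `V`
and `ξ`, `η` in the Hilbert-Schmidt unit balls (`dual_sandwich`). The problem thus becomes scalar: a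
functional on a fibre of `M_{k,l}(V)` must extend to a contractive `C(X)`-linear map into `C(X)`.

Such a map is a family of functionals `G y`, continuous in `y` and dominated by the fibre seminorm
at `y`; linearity over `C(X)` is automatic because that seminorm kills `f • z` when `f y = 0`. If
the fibre seminorms are lower semicontinuous in `y`, Hahn-Banach makes the dual balls a lower
semicontinuous set-valued map, and Michael selection, with the ball at `x` shrunk to `{F}`, yields
the family. Separability places these balls in the space of sequences.

Lower semicontinuity has two sources. For matrices over `A`, only the norms of entries are known to
be continuous; these determine the matrix norm up to a constant factor, which the C⋆-identity
removes by passing to high powers. For `traceSeminorm`, factorizations at nearby points involve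
matrices of unbounded size; a polar decomposition (`exists_contraction_mul_eq`) moves the scalar
factors to the fixed sizes k and l, where compactness applies. -/

noncomputable section

namespace CXWittstock

open Filter Topology
open scoped Matrix Pointwise InnerProductSpace WithCStarModule

/-! ### Lower semicontinuous families of seminorms and Michael selection of functionals -/

section Selection

variable {X : Type*} [TopologicalSpace X]

/-- A family of seminorms, lower semicontinuous in the parameter, is so uniformly on the
finite-dimensional subspaces. -/
lemma eventually_seminorm_sum_le {E ι : Type*} [AddCommGroup E] [Module ℂ E] [Fintype ι]
    {N : X → Seminorm ℂ E} {p : Seminorm ℂ E} (hNp : ∀ y z, N y z ≤ p z)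
    (hN : ∀ z, LowerSemicontinuous fun y => N y z) (y₀ : X) (b : ι → E) {ε : ℝ} (hε : 0 < ε) :
    ∀ᶠ y in 𝓝 y₀, ∀ t : ι → ℂ,
      N y₀ (∑ i, t i • b i) ≤ N y (∑ i, t i • b i) + ε * ‖t‖ := by
  set C : ℝ := ∑ i, p (b i) with hC
  have hC0 : 0 ≤ C := Finset.sum_nonneg fun i _ => apply_nonneg p _
  -- Domination by `p` makes the Lipschitz constant independent of `y`; compactness of the unit ball
  -- then gives uniformity in `t`.
  have lip (y : X) (s t : ι → ℂ) :
      N y (∑ i, s i • b i) ≤ N y (∑ i, t i • b i) + ‖s - t‖ * C := by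
    have h1 : ∑ i, s i • b i = ∑ i, t i • b i + ∑ i, (s - t) i • b i := by
      rw [← Finset.sum_add_distrib]
      exact Finset.sum_congr rfl fun i _ => by simp [sub_smul]
    have h2 : p (∑ i, (s - t) i • b i) ≤ ‖s - t‖ * C := by
      refine (Finset.le_sum_of_subadditive p (map_zero p).le (map_add_le_add p) _ _).trans ?_
      rw [hC, Finset.mul_sum]
      refine Finset.sum_le_sum fun i _ => ?_
      rw [map_smul_eq_mul]
      gcongr
      exact norm_le_pi_norm (s - t) i
    rw [h1]
    exact (map_add_le_add _ _ _).trans (by gcongr; exact (hNp _ _).trans h2)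
  have key : ∀ᶠ y in 𝓝 y₀, ∀ t ∈ Metric.closedBall (0 : ι → ℂ) 1,
      N y₀ (∑ i, t i • b i) ≤ N y (∑ i, t i • b i) + ε := by
    refine IsCompact.eventually_forall_of_forall_eventually
      (P := fun (y : X) (t : ι → ℂ) => N y₀ (∑ i, t i • b i) ≤ N y (∑ i, t i • b i) + ε)
      (isCompact_closedBall _ _) fun s _ => ?_
    have h1 := hN (∑ i, s i • b i) y₀ (N y₀ (∑ i, s i • b i) - ε / 3) (by linarith)
    have h2 : ∀ᶠ t in 𝓝 s, ‖t - s‖ * C < ε / 3 := by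
      have : Tendsto (fun t => ‖t - s‖ * C) (𝓝 s) (𝓝 (‖s - s‖ * C)) := by
        apply Continuous.tendsto; fun_prop
      rw [sub_self, norm_zero, zero_mul] at this
      exact this.eventually_lt_const (by positivity)
    rw [nhds_prod_eq]
    filter_upwards [h1.prod_mk h2] with ⟨y, t⟩ ⟨hy, ht⟩
    have h3 := lip y₀ t s
    have h4 := lip y s t
    rw [norm_sub_rev] at h4
    dsimp only at *
    linarith
  filter_upwards [key] with y hy t
  rcases eq_or_ne t 0 with rfl | ht
  · simp
  have ht' : 0 < ‖t‖ := norm_pos_iff.2 ht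
  have hs := hy ((‖t‖⁻¹ : ℂ) • t) (by simp [norm_smul, ht'.ne'])
  have hsum : ∑ i, ((‖t‖⁻¹ : ℂ) • t) i • b i = (‖t‖⁻¹ : ℂ) • ∑ i, t i • b i := by
    simp [Finset.smul_sum, smul_smul]
  rw [hsum, map_smul_eq_mul, map_smul_eq_mul] at hs
  simp only [norm_inv, Complex.norm_real, norm_norm] at hs
  have := mul_le_mul_of_nonneg_left hs ht'.le
  rw [mul_add, ← mul_assoc, ← mul_assoc, mul_inv_cancel₀ ht'.ne'] at this
  linarith

/-- A functional dominated by one member of a lower semicontinuous family of seminorms can be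
approximated, on finitely many vectors, by functionals dominated by the nearby members. -/
lemma eventually_exists_dual_approx {E ι : Type*} [AddCommGroup E] [Module ℂ E] [Fintype ι]
    {N : X → Seminorm ℂ E} {p : Seminorm ℂ E} (hNp : ∀ y z, N y z ≤ p z)
    (hN : ∀ z, LowerSemicontinuous fun y => N y z) (y₀ : X) (F : Module.Dual ℂ E)
    (hF : ∀ z, ‖F z‖ ≤ N y₀ z) (b : ι → E) {ε : ℝ} (hε : 0 < ε) :
    ∀ᶠ y in 𝓝 y₀, ∃ G : Module.Dual ℂ E, (∀ z, ‖G z‖ ≤ N y z) ∧ ∀ i, ‖G (b i) - F (b i)‖ ≤ ε := by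
  classical
  filter_upwards [eventually_seminorm_sum_le hNp hN y₀ b hε] with y hy
  let L : (ι → ℂ) →ₗ[ℂ] E := Fintype.linearCombination ℂ b
  have hL (t : ι → ℂ) : L t = ∑ i, t i • b i := rfl
  -- Hahn-Banach on the graph of `L`: the second coordinate absorbs the error `ε * ‖t‖`. Restricting
  -- the extension to `E` gives domination by `N y`, and what is lost at `b i` is its value at the
  -- i-th unit vector, at most `ε`.
  let q : Seminorm ℂ (E × (ι → ℂ)) := (N y).comp (LinearMap.fst ℂ E (ι → ℂ)) +
    (ε.toNNReal) • (normSeminorm ℂ (ι → ℂ)).comp (LinearMap.snd ℂ E (ι → ℂ))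
  have hq (a : E × (ι → ℂ)) : q a = N y a.1 + ε * ‖a.2‖ := by
    change N y a.1 + ε.toNNReal * ‖a.2‖ = _
    rw [Real.coe_toNNReal _ hε.le]
  let S : Submodule ℂ (E × (ι → ℂ)) := LinearMap.range (L.prod LinearMap.id)
  let f : Module.Dual ℂ S := F ∘ₗ L ∘ₗ (LinearMap.snd ℂ E (ι → ℂ)) ∘ₗ S.subtype
  obtain ⟨g, hg, hgq⟩ := Module.Dual.exists_extension_of_le_seminorm S f (p := q) (by
    rintro ⟨_, t, rfl⟩
    rw [hq]
    change ‖F (L t)‖ ≤ N y (L t) + ε * ‖t‖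
    exact (hF _).trans (hy t))
  refine ⟨g ∘ₗ LinearMap.inl ℂ E (ι → ℂ), fun z => ?_, fun i => ?_⟩
  · simpa [hq] using hgq (z, 0)
  · have h1 : g (L (Pi.single i 1), Pi.single i 1) = F (L (Pi.single i 1)) :=
      hg ⟨_, Pi.single i 1, rfl⟩
    have h2 : L (Pi.single i 1) = b i := by simp [L]
    have h3 : g (b i, Pi.single i 1) = g (b i, 0) + g (0, Pi.single i 1) := by
      rw [← map_add]; simp
    rw [h2] at h1
    have h4 := hgq (0, Pi.single i 1)
    simp only [hq, map_zero, zero_add, Pi.norm_single, norm_one, mul_one] at h4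
    rw [LinearMap.comp_apply, LinearMap.inl_apply, ← h1, h3, norm_sub_rev, add_sub_cancel_left]
    exact h4

/-- **Michael's selection theorem** for set-valued maps into the space of sequences. -/
lemma exists_continuous_forall_mem_closure [NormalSpace X] [ParacompactSpace X] [CompactSpace X]
    (S : X → Set (ℕ → ℂ)) (hconv : ∀ y, Convex ℝ (S y)) (hne : ∀ y, (S y).Nonempty)
    (hlsc : ∀ y₀, ∀ c ∈ S y₀, ∀ (m : ℕ) (ε : ℝ), 0 < ε →
      ∀ᶠ y in 𝓝 y₀, ∃ d ∈ S y, ∀ i < m, ‖d i - c i‖ < ε) :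
    ∃ f : ℕ → C(X, ℂ), ∀ y, (fun i => f i y) ∈ closure (S y) := by
  have nearConvex (T : Set (ℕ → ℂ)) (hT : Convex ℝ T) (m : ℕ) (ε : ℝ) :
      Convex ℝ {d : ℕ → ℂ | ∃ c ∈ T, ∀ i < m, ‖d i - c i‖ < ε} := by
    rintro d₁ ⟨c₁, hc₁, h₁⟩ d₂ ⟨c₂, hc₂, h₂⟩ a b ha hb hab
    refine ⟨a • c₁ + b • c₂, hT hc₁ hc₂ ha hb hab, fun i hi => ?_⟩
    have := (convex_ball (0 : ℂ) ε) (mem_ball_zero_iff.2 (h₁ i hi))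
      (mem_ball_zero_iff.2 (h₂ i hi)) ha hb hab
    rw [mem_ball_zero_iff] at this
    have h : (a • d₁ + b • d₂) i - (a • c₁ + b • c₂) i =
        a • (d₁ i - c₁ i) + b • (d₂ i - c₂ i) := by
      simp only [Pi.add_apply, Pi.smul_apply]
      module
    rwa [h]
  -- Stage `m` controls only the first `m` coordinates, which is all that lower semicontinuity in
  -- the product topology offers. A nearby point of `S y₀` serves locally as a constant selection,
  -- and a partition of unity glues.
  have step (m : ℕ) (f : C(X, ℕ → ℂ))
      (hf : ∀ y, ∃ c ∈ S y, ∀ i < m, ‖f y i - c i‖ < (1 / 2 : ℝ) ^ m) :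
      ∃ g : C(X, ℕ → ℂ), (∀ y, ∃ c ∈ S y, ∀ i < m + 1, ‖g y i - c i‖ < (1 / 2 : ℝ) ^ (m + 1)) ∧
        ∀ y, ∀ i < m, ‖g y i - f y i‖ < (1 / 2 : ℝ) ^ m := by
    obtain ⟨g, hg⟩ := exists_continuous_forall_mem_convex_of_local_const
      (t := fun y => {d : ℕ → ℂ | ∃ c ∈ S y, ∀ i < m + 1, ‖d i - c i‖ < (1 / 2 : ℝ) ^ (m + 1)} ∩
        {d : ℕ → ℂ | ∃ c ∈ ({f y} : Set (ℕ → ℂ)), ∀ i < m, ‖d i - c i‖ < (1 / 2 : ℝ) ^ m})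
      (fun y => (nearConvex _ (hconv y) _ _).inter (nearConvex _ (convex_singleton _) _ _))
      (fun y₀ => by
        obtain ⟨c, hc, hcf⟩ := hf y₀
        refine ⟨c, ?_⟩
        have h1 := hlsc y₀ c hc (m + 1) ((1 / 2 : ℝ) ^ (m + 1)) (by positivity)
        have h2 : ∀ᶠ y in 𝓝 y₀, ∀ i ∈ Finset.range m, ‖f y i - c i‖ < (1 / 2 : ℝ) ^ m := by
          rw [Filter.eventually_all_finset]
          intro i hi
          have hcont : Continuous fun y => ‖f y i - c i‖ := by fun_prop
          exact hcont.continuousAt.eventually_lt_const (hcf i (Finset.mem_range.1 hi))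
        filter_upwards [h1, h2] with y ⟨d, hd, hdc⟩ hy
        refine ⟨⟨d, hd, fun i hi => ?_⟩, f y, rfl, fun i hi => ?_⟩
        · rw [norm_sub_rev]; exact hdc i hi
        · rw [norm_sub_rev]; exact hy i (Finset.mem_range.2 hi))
    exact ⟨g, fun y => (hg y).1, fun y i hi => by
      obtain ⟨c, rfl, hc⟩ := (hg y).2
      exact hc i hi⟩
  let P (m : ℕ) := {f : C(X, ℕ → ℂ) // ∀ y, ∃ c ∈ S y, ∀ i < m, ‖f y i - c i‖ < (1 / 2 : ℝ) ^ m}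
  have hstep (m : ℕ) (f : P m) :
      ∃ g : P (m + 1), ∀ y, ∀ i < m, ‖g.1 y i - f.1 y i‖ < (1 / 2 : ℝ) ^ m := by
    obtain ⟨g, h1, h2⟩ := step m f.1 f.2
    exact ⟨⟨g, h1⟩, h2⟩
  choose next hnext using hstep
  obtain ⟨w, hw, hu⟩ : ∃ w : ℕ → C(X, ℕ → ℂ),
      (∀ m y, ∃ c ∈ S y, ∀ i < m, ‖w m y i - c i‖ < (1 / 2 : ℝ) ^ m) ∧
        ∀ m y, ∀ i < m, ‖w (m + 1) y i - w m y i‖ < (1 / 2 : ℝ) ^ m := by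
    let u : ∀ m, P m := fun m => Nat.rec
      ⟨0, fun y => (hne y).imp fun c hc => ⟨hc, fun i hi => absurd hi (Nat.not_lt_zero i)⟩⟩ next m
    exact ⟨fun m => (u m).1, fun m => (u m).2, fun m => hnext m (u m)⟩
  let v (i m : ℕ) : C(X, ℂ) := ⟨fun y => w m y i, by fun_prop⟩
  have hv (i : ℕ) : ∃ f : C(X, ℂ), Tendsto (v i) atTop (𝓝 f) := by
    -- Coordinate `i` is controlled only from stage `i + 1` on, hence the shift.
    have hc : CauchySeq fun m => v i (m + (i + 1)) := by
      refine cauchySeq_of_le_geometric (1 / 2 : ℝ) 1 (by norm_num) fun m => ?_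
      rw [ContinuousMap.dist_le (by positivity)]
      intro y
      rw [dist_comm, dist_eq_norm, one_mul, add_right_comm]
      refine (hu (m + (i + 1)) y i (by omega)).le.trans ?_
      exact pow_le_pow_of_le_one (by norm_num) (by norm_num) (by omega)
    obtain ⟨f, hf⟩ := cauchySeq_tendsto_of_complete hc
    exact ⟨f, (tendsto_add_atTop_iff_nat (i + 1)).1 hf⟩
  choose f hf using hv
  refine ⟨f, fun y => ?_⟩
  choose c hcS hc using fun m => hw m y
  refine mem_closure_of_tendsto (b := atTop) (tendsto_pi_nhds.2 fun i => ?_)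
    (Eventually.of_forall hcS)
  have h1 : Tendsto (fun m => v i m y) atTop (𝓝 (f i y)) :=
    ((continuous_eval_const y).tendsto (f i)).comp (hf i)
  have h2 : Tendsto (fun m => v i m y - c m i) atTop (𝓝 0) := by
    refine squeeze_zero_norm' ?_
      (tendsto_pow_atTop_nhds_zero_of_lt_one (by norm_num : (0 : ℝ) ≤ 1 / 2) (by norm_num))
    filter_upwards [eventually_gt_atTop i] with m hm
    exact (hc m i hm).le
  simpa using h1.sub h2

/-- A functional dominated by one member of a lower semicontinuous family of seminorms on a
separable space belongs to a continuous family of functionals dominated by these seminorms. -/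
lemma exists_continuous_dual_family [CompactSpace X] [T2Space X] {E : Type*} [AddCommGroup E]
    [Module ℂ E] {N : X → Seminorm ℂ E} {p : Seminorm ℂ E} (hNp : ∀ y z, N y z ≤ p z)
    (hN : ∀ z, LowerSemicontinuous fun y => N y z)
    (hsep : ∃ b : ℕ → E, ∀ z, ∀ ε > 0, ∃ i, p (z - b i) < ε)
    (x : X) (F : Module.Dual ℂ E) (hF : ∀ z, ‖F z‖ ≤ N x z) :
    ∃ G : X → Module.Dual ℂ E, (∀ y z, ‖G y z‖ ≤ N y z) ∧ (∀ z, Continuous fun y => G y z) ∧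
      G x = F := by
  classical
  obtain ⟨b, hb⟩ := hsep
  -- Shrinking the set at `x` to `{F}` forces the selection through `F`; lower semicontinuity
  -- survives because points are closed.
  let K (y : X) : Set (Module.Dual ℂ E) := {G | (∀ z, ‖G z‖ ≤ N y z) ∧ (y = x → G = F)}
  let ev (g : E → ℂ) : ℕ → ℂ := fun i => g (b i)
  have hev : Continuous ev := by fun_prop
  -- Banach-Alaoglu: the image is compact, so a selection in the closure comes from actual
  -- functionals.
  have hKclosed (y : X) : IsClosed (ev '' ((fun G : Module.Dual ℂ E => (G : E → ℂ)) '' K y)) := by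
    refine (IsCompact.image ?_ hev).isClosed
    have hball : IsCompact (Set.univ.pi fun z : E => Metric.closedBall (0 : ℂ) (N y z)) :=
      isCompact_univ_pi fun z => isCompact_closedBall _ _
    refine hball.of_isClosed_subset ?_ ?_
    · have : ((fun G : Module.Dual ℂ E => (G : E → ℂ)) '' K y) =
          (Set.range fun G : Module.Dual ℂ E => (G : E → ℂ)) ∩
            {g | (∀ z, ‖g z‖ ≤ N y z) ∧ (y = x → g = F)} := by
        ext g
        constructor
        · rintro ⟨G, ⟨h1, h2⟩, rfl⟩
          exact ⟨⟨G, rfl⟩, h1, fun h => by rw [h2 h]⟩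
        · rintro ⟨⟨G, rfl⟩, h1, h2⟩
          exact ⟨G, ⟨h1, fun h => DFunLike.coe_injective (h2 h)⟩, rfl⟩
      rw [this]
      refine (LinearMap.isClosed_range_coe _ _ _).inter ?_
      refine IsClosed.and ?_ ?_
      · simp only [Set.ofPred_forall]
        exact isClosed_iInter fun z => isClosed_le (by fun_prop) continuous_const
      · by_cases hy : y = x
        · simp [hy]
        · simp [hy]
    · rintro _ ⟨G, ⟨h1, -⟩, rfl⟩ z -
      simpa using h1 z
  have hKsub (y₀ : X) (G₀ : Module.Dual ℂ E) (hG₀ : ∀ z, ‖G₀ z‖ ≤ N y₀ z) (h₀ : y₀ = x → G₀ = F)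
      (m : ℕ) (ε : ℝ) (hε : 0 < ε) :
      ∀ᶠ y in 𝓝 y₀, ∃ G ∈ K y, ∀ i < m, ‖G (b i) - G₀ (b i)‖ < ε := by
    have h1 := eventually_exists_dual_approx hNp hN y₀ G₀ hG₀ (fun i : Fin m => b i)
      (half_pos hε)
    by_cases hy : y₀ = x
    · filter_upwards [h1] with y ⟨G, hG, hGb⟩
      by_cases hyx : y = x
      · refine ⟨G₀, ⟨fun z => ?_, fun _ => h₀ hy⟩, fun i _ => by simpa using hε⟩
        rw [hyx, ← hy]; exact hG₀ z
      · exact ⟨G, ⟨hG, fun h => absurd h hyx⟩, fun i hi =>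
          (hGb ⟨i, hi⟩).trans_lt (half_lt_self hε)⟩
    · filter_upwards [h1, isOpen_ne.mem_nhds hy] with y ⟨G, hG, hGb⟩ hyx
      exact ⟨G, ⟨hG, fun h => absurd h hyx⟩, fun i hi =>
        (hGb ⟨i, hi⟩).trans_lt (half_lt_self hε)⟩
  obtain ⟨f, hf⟩ := exists_continuous_forall_mem_closure
    (fun y => ev '' ((fun G : Module.Dual ℂ E => (G : E → ℂ)) '' K y))
    (by
      rintro y _ ⟨_, ⟨G₁, ⟨h1, h1'⟩, rfl⟩, rfl⟩ _ ⟨_, ⟨G₂, ⟨h2, h2'⟩, rfl⟩, rfl⟩ s t hs ht hst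
      refine ⟨_, ⟨(s : ℂ) • G₁ + (t : ℂ) • G₂, ⟨fun z => ?_, fun h => ?_⟩, rfl⟩, ?_⟩
      · calc ‖((s : ℂ) • G₁ + (t : ℂ) • G₂) z‖ ≤ ‖(s : ℂ) * G₁ z‖ + ‖(t : ℂ) * G₂ z‖ :=
              norm_add_le _ _
          _ = s * ‖G₁ z‖ + t * ‖G₂ z‖ := by
              simp [abs_of_nonneg hs, abs_of_nonneg ht]
          _ ≤ s * N y z + t * N y z := by gcongr <;> simp [h1, h2]
          _ = N y z := by rw [← add_mul, hst, one_mul]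
      · rw [h1' h, h2' h, ← add_smul, ← Complex.ofReal_add, hst]; simp
      · ext i
        simp [ev])
    (by
      intro y
      by_cases hy : y = x
      · exact ⟨_, _, ⟨F, ⟨fun z => hy ▸ hF z, fun _ => rfl⟩, rfl⟩, rfl⟩
      · exact ⟨_, _, ⟨0, ⟨fun z => by simp, fun h => absurd h hy⟩, rfl⟩, rfl⟩)
    (by
      rintro y₀ _ ⟨_, ⟨G₀, ⟨hG₀, h₀⟩, rfl⟩, rfl⟩ m ε hε
      filter_upwards [hKsub y₀ G₀ hG₀ h₀ m ε hε] with y ⟨G, hG, hGb⟩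
      exact ⟨_, ⟨_, ⟨G, hG, rfl⟩, rfl⟩, hGb⟩)
  have hG (y : X) : ∃ G ∈ K y, ∀ i, G (b i) = f i y := by
    have := hf y
    rw [(hKclosed y).closure_eq] at this
    obtain ⟨_, ⟨G, hG, rfl⟩, h⟩ := this
    exact ⟨G, hG, fun i => congrFun h i⟩
  choose G hGK hGb using hG
  refine ⟨G, fun y => (hGK y).1, fun z => ?_, (hGK x).2 rfl⟩
  refine continuous_of_uniform_approx_of_continuous fun U hU => ?_
  obtain ⟨ε, hε, hεU⟩ := Metric.mem_uniformity_dist.1 hU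
  obtain ⟨i, hi⟩ := hb z ε hε
  refine ⟨f i, (f i).continuous, fun y => hεU ?_⟩
  rw [dist_eq_norm, ← hGb, ← map_sub]
  exact (((hGK y).1 _).trans (hNp _ _)).trans_lt hi

end Selection

/-! ### Fibre seminorms of a `C(X)`-module -/

section LocalSeminorm

variable {X : Type*} [TopologicalSpace X] [CompactSpace X]

/-- The contractive functions that take the value `1` at `y`. -/
def peakFunctions (y : X) : Set C(X, ℂ) := {g | ‖g‖ ≤ 1 ∧ g y = 1}

lemma one_mem_peakFunctions (y : X) : (1 : C(X, ℂ)) ∈ peakFunctions y :=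
  ⟨(ContinuousMap.norm_le _ zero_le_one).2 fun _ => by simp, rfl⟩

instance (y : X) : Nonempty (peakFunctions y) := ⟨⟨1, one_mem_peakFunctions y⟩⟩

lemma mul_mem_peakFunctions {y : X} {g h : C(X, ℂ)} (hg : g ∈ peakFunctions y)
    (hh : h ∈ peakFunctions y) : g * h ∈ peakFunctions y :=
  ⟨(norm_mul_le _ _).trans (mul_le_one₀ hg.1 (norm_nonneg _) hh.1), by simp [hg.2, hh.2]⟩

/-- A function vanishing at `y` is small near `y`. -/
lemma exists_mem_peakFunctions_norm_mul_le {y : X} {h : C(X, ℂ)} (hh : h y = 0) {ε : ℝ}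
    (hε : 0 < ε) : ∃ g ∈ peakFunctions y, ‖g * h‖ ≤ ε := by
  have hcont : Continuous fun z => ((max 0 (1 - ‖h z‖ / ε) : ℝ) : ℂ) := by fun_prop
  have hval (z : X) : ‖((max 0 (1 - ‖h z‖ / ε) : ℝ) : ℂ)‖ = max 0 (1 - ‖h z‖ / ε) := by
    rw [Complex.norm_real, Real.norm_of_nonneg (le_max_left _ _)]
  refine ⟨⟨_, hcont⟩, ⟨(ContinuousMap.norm_le _ zero_le_one).2 fun z => ?_, ?_⟩,
    (ContinuousMap.norm_le _ hε.le).2 fun z => ?_⟩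
  · rw [ContinuousMap.coe_mk, hval]
    exact max_le zero_le_one (by linarith [show 0 ≤ ‖h z‖ / ε by positivity])
  · simp [hh]
  · rw [ContinuousMap.mul_apply, norm_mul, ContinuousMap.coe_mk, hval]
    rcases le_total ‖h z‖ ε with hz | hz
    · refine (mul_le_of_le_one_left (norm_nonneg _) ?_).trans hz
      exact max_le zero_le_one (by linarith [show 0 ≤ ‖h z‖ / ε by positivity])
    · rw [max_eq_left, zero_mul]
      · exact hε.le
      · linarith [(one_le_div hε).2 hz]

variable {E : Type*} [AddCommGroup E] [Module ℂ E] [Module C(X, ℂ) E] [IsScalarTower ℂ C(X, ℂ) E]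

/-- The seminorm `z ↦ inf {p (g z) : ‖g‖ ≤ 1, g y = 1}` of the fibre at `y`, for a seminorm `p`
on a `C(X)`-module that is compatible with the module structure. -/
def localSeminorm (p : Seminorm ℂ E) (hp : ∀ (g : C(X, ℂ)) z, p (g • z) ≤ ‖g‖ * p z) (y : X) :
    Seminorm ℂ E :=
  have hbdd (z : E) : BddBelow (Set.range fun g : peakFunctions y => p (g.1 • z)) :=
    ⟨0, by rintro _ ⟨g, rfl⟩; exact apply_nonneg _ _⟩
  Seminorm.ofSMulLE (fun z => ⨅ g : peakFunctions y, p (g.1 • z))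
    (le_antisymm ((ciInf_le (hbdd 0) ⟨1, one_mem_peakFunctions y⟩).trans (by simp))
      (le_ciInf fun g => apply_nonneg _ _))
    (fun z w => by
      refine le_ciInf_add_ciInf fun g h => ?_
      -- The product of the two peak functions is admissible for both summands.
      refine (ciInf_le (hbdd _) ⟨g.1 * h.1, mul_mem_peakFunctions g.2 h.2⟩).trans ?_
      dsimp only
      rw [smul_add]
      refine (map_add_le_add _ _ _).trans (add_le_add ?_ ?_)
      · rw [mul_comm, mul_smul]
        exact (hp _ _).trans (mul_le_of_le_one_left (apply_nonneg _ _) h.2.1)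
      · rw [mul_smul]
        exact (hp _ _).trans (mul_le_of_le_one_left (apply_nonneg _ _) g.2.1))
    (fun r z => by
      rw [Real.mul_iInf_of_nonneg (norm_nonneg r)]
      refine le_of_eq (iInf_congr fun g => ?_)
      rw [← smul_comm, map_smul_eq_mul])

section

variable {p : Seminorm ℂ E} {hp : ∀ (g : C(X, ℂ)) z, p (g • z) ≤ ‖g‖ * p z} {y : X}

lemma localSeminorm_le_smul {g : C(X, ℂ)} (hg : g ∈ peakFunctions y) (z : E) :
    localSeminorm p hp y z ≤ p (g • z) :=
  ciInf_le (f := fun g : peakFunctions y => p (g.1 • z))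
    ⟨0, by rintro _ ⟨g, rfl⟩; exact apply_nonneg _ _⟩ ⟨g, hg⟩

lemma localSeminorm_le (z : E) : localSeminorm p hp y z ≤ p z := by
  simpa using localSeminorm_le_smul (hp := hp) (one_mem_peakFunctions y) z

lemma le_localSeminorm {z : E} {r : ℝ} (h : ∀ g ∈ peakFunctions y, r ≤ p (g • z)) :
    r ≤ localSeminorm p hp y z :=
  le_ciInf fun g => h g.1 g.2

lemma exists_lt_of_localSeminorm_lt {z : E} {r : ℝ} (h : localSeminorm p hp y z < r) :
    ∃ g ∈ peakFunctions y, p (g • z) < r := by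
  by_contra! hcon
  exact absurd (le_localSeminorm hcon) (not_le.2 h)

lemma localSeminorm_smul_eq_zero {h : C(X, ℂ)} (hh : h y = 0) (z : E) :
    localSeminorm p hp y (h • z) = 0 := by
  refine le_antisymm (le_of_forall_pos_le_add fun ε hε => ?_) (apply_nonneg _ _)
  have hpz : 0 < p z + 1 := by linarith [apply_nonneg p z]
  obtain ⟨g, hg, hgh⟩ := exists_mem_peakFunctions_norm_mul_le hh (div_pos hε hpz)
  refine (localSeminorm_le_smul hg _).trans ?_
  rw [smul_smul, zero_add]
  refine (hp _ _).trans ((mul_le_mul_of_nonneg_right hgh (apply_nonneg p z)).trans ?_)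
  rw [div_mul_eq_mul_div, div_le_iff₀ hpz]
  nlinarith

end

/-- In a separable `C(X)`-module whose local seminorms are continuous, a functional on a fibre
extends to a contractive `C(X)`-linear map to `C(X)`. -/
theorem exists_linearMap_extending_dual [T2Space X] (p : Seminorm ℂ E)
    (hp : ∀ (g : C(X, ℂ)) z, p (g • z) ≤ ‖g‖ * p z)
    (hlsc : ∀ z, LowerSemicontinuous fun y => localSeminorm p hp y z)
    (hsep : ∃ b : ℕ → E, ∀ z, ∀ ε > 0, ∃ i, p (z - b i) < ε)
    (x : X) (F : Module.Dual ℂ E) (hF : ∀ z, ‖F z‖ ≤ localSeminorm p hp x z) :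
    ∃ Φ : E →ₗ[C(X, ℂ)] C(X, ℂ), (∀ z y, ‖Φ z y‖ ≤ p z) ∧ ∀ z, Φ z x = F z := by
  obtain ⟨G, hG, hcont, hGx⟩ := exists_continuous_dual_family
    (fun y z => localSeminorm_le (hp := hp) z) hlsc hsep x F hF
  refine ⟨{ toFun := fun z => ⟨fun y => G y z, hcont z⟩
            map_add' := fun z w => by ext y; simp
            map_smul' := fun g z => ?_ }, fun z y => (hG y z).trans (localSeminorm_le z), ?_⟩
  · ext y
    have h1 : g • z = g y • z + (g - algebraMap ℂ C(X, ℂ) (g y)) • z := by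
      rw [sub_smul, algebraMap_smul]; abel
    have h2 : G y ((g - algebraMap ℂ C(X, ℂ) (g y)) • z) = 0 := by
      rw [← norm_le_zero_iff]
      exact (hG y _).trans (localSeminorm_smul_eq_zero (by simp) z).le
    simp only [ContinuousMap.coe_mk, RingHom.id_apply, smul_eq_mul, ContinuousMap.mul_apply]
    rw [h1, map_add, h2, map_smul, add_zero, smul_eq_mul]
  · intro z
    simp [hGx]

end LocalSeminorm

/-! ### Norms of rectangular matrices over a C⋆-algebra -/

section RectangularMatrices

/-- Matrices act on row vectors from the right, so the order of composition is reversed. -/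
lemma toCLM_mul_apply {A m n o : Type*} [CStarAlgebra A] [Fintype m] [Fintype n]
    (M : CStarMatrix m n A) (N : CStarMatrix n o A) (v : C⋆ᵐᵒᵈ(A, m → A)) :
    CStarMatrix.toCLM (M * N) v = CStarMatrix.toCLM N (CStarMatrix.toCLM M v) := by
  simp only [CStarMatrix.toCLM_apply]
  exact congrArg _ (Matrix.vecMul_vecMul (α := A) (v : m → A) M N).symm

variable {A : Type*} [CStarAlgebra A] [PartialOrder A] [StarOrderedRing A]
variable {m n o : Type*} [Fintype m] [Fintype n] [Fintype o]

lemma cstarMatrix_norm_mul_le (M : CStarMatrix m n A) (N : CStarMatrix n o A) :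
    ‖M * N‖ ≤ ‖M‖ * ‖N‖ := by
  rw [CStarMatrix.norm_def]
  refine ContinuousLinearMap.opNorm_le_bound _ (by positivity) fun v => ?_
  rw [toCLM_mul_apply, mul_comm ‖M‖, mul_assoc]
  exact (ContinuousLinearMap.le_opNorm _ _).trans
    (mul_le_mul_of_nonneg_left (ContinuousLinearMap.le_opNorm _ _) (norm_nonneg _))

/-- Cauchy-Schwarz applied to `⟪vM, vM⟫ = ⟪v, vMMᴴ⟫`. -/
lemma cstarMatrix_sq_norm_le (M : CStarMatrix m n A) : ‖M‖ ^ 2 ≤ ‖M * M.conjTranspose‖ := by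
  have key : ‖M‖ ≤ √‖M * M.conjTranspose‖ := by
    rw [CStarMatrix.norm_def (M := M)]
    refine ContinuousLinearMap.opNorm_le_bound _ (Real.sqrt_nonneg _) fun v => ?_
    refine le_of_sq_le_sq ?_ (by positivity)
    rw [mul_pow, Real.sq_sqrt (norm_nonneg _), CStarModule.norm_sq_eq (A := A),
      ← CStarMatrix.inner_toCLM_conjTranspose_right]
    calc _ ≤ ‖v‖ * ‖CStarMatrix.toCLM (M * M.conjTranspose) v‖ := by
          rw [toCLM_mul_apply]
          exact CStarModule.norm_inner_le (C⋆ᵐᵒᵈ(A, m → A))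
      _ ≤ ‖v‖ * (‖M * M.conjTranspose‖ * ‖v‖) := by
          gcongr
          exact ContinuousLinearMap.le_opNorm _ _
      _ = _ := by ring
  calc ‖M‖ ^ 2 ≤ √‖M * M.conjTranspose‖ ^ 2 := by gcongr
    _ = _ := Real.sq_sqrt (norm_nonneg _)

lemma cstarMatrix_norm_le_norm_conjTranspose (M : CStarMatrix m n A) :
    ‖M‖ ≤ ‖M.conjTranspose‖ := by
  rcases (norm_nonneg M).eq_or_lt with h | h
  · rw [← h]; exact norm_nonneg _
  · refine le_of_mul_le_mul_left ?_ h
    rw [← sq]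
    exact (cstarMatrix_sq_norm_le M).trans (cstarMatrix_norm_mul_le _ _)

lemma cstarMatrix_norm_conjTranspose (M : CStarMatrix m n A) : ‖M.conjTranspose‖ = ‖M‖ := by
  have hM : M.conjTranspose.conjTranspose = M := by ext i j; simp
  refine le_antisymm ?_ (cstarMatrix_norm_le_norm_conjTranspose M)
  exact (cstarMatrix_norm_le_norm_conjTranspose M.conjTranspose).trans (by rw [hM])

lemma cstarMatrix_norm_mul_conjTranspose (M : CStarMatrix m n A) :
    ‖M * M.conjTranspose‖ = ‖M‖ ^ 2 := by
  refine le_antisymm ?_ (cstarMatrix_sq_norm_le M)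
  refine (cstarMatrix_norm_mul_le _ _).trans ?_
  rw [cstarMatrix_norm_conjTranspose, sq]

lemma cstarMatrix_norm_le_sum (M : CStarMatrix m n A) : ‖M‖ ≤ ∑ i, ∑ j, ‖M i j‖ := by
  rw [CStarMatrix.norm_def]
  refine (CStarMatrix.toCLM M).opNorm_le_bound (by positivity) fun v => ?_
  rw [Finset.sum_comm]
  simp only [CStarMatrix.toCLM_apply_eq_sum, Finset.sum_mul]
  refine (WithCStarModule.pi_norm_le_sum_norm _).trans ?_
  gcongr with i _
  refine (norm_sum_le _ _).trans ?_
  gcongr with j _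
  refine (norm_mul_le _ _).trans ?_
  rw [mul_comm]
  gcongr
  exact WithCStarModule.norm_apply_le_norm v j

/-- A corner of a coisometry is a contraction. -/
lemma cstarMatrix_norm_le_one [DecidableEq m] (M : CStarMatrix m n A) (D : CStarMatrix m o A)
    (h : M * M.conjTranspose + D * D.conjTranspose = 1) : ‖M‖ ≤ 1 := by
  rw [CStarMatrix.norm_def]
  refine ContinuousLinearMap.opNorm_le_bound _ zero_le_one fun v => ?_
  refine le_of_sq_le_sq ?_ (by positivity)
  rw [one_mul, CStarModule.norm_sq_eq (A := A), CStarModule.norm_sq_eq (A := A)]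
  refine CStarAlgebra.norm_le_norm_of_nonneg_of_le CStarModule.inner_self_nonneg ?_
  have h1 : CStarMatrix.toCLM (1 : CStarMatrix m m A) v = v := by
    rw [CStarMatrix.toCLM_apply]
    exact congrArg _ (Matrix.vecMul_one (α := A) (v : m → A))
  have h2 : ⟪v, v⟫_A = ⟪CStarMatrix.toCLM M v, CStarMatrix.toCLM M v⟫_A +
      ⟪CStarMatrix.toCLM D v, CStarMatrix.toCLM D v⟫_A := by
    calc ⟪v, v⟫_A = ⟪v, CStarMatrix.toCLM (M * M.conjTranspose + D * D.conjTranspose) v⟫_A := by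
          rw [h, h1]
      _ = _ := by
          rw [map_add, add_apply, CStarModule.inner_add_right, toCLM_mul_apply, toCLM_mul_apply]
          exact congrArg₂ (· + ·) CStarMatrix.inner_toCLM_conjTranspose_right
            CStarMatrix.inner_toCLM_conjTranspose_right
  rw [h2]
  exact le_add_of_nonneg_right CStarModule.inner_self_nonneg

/-- The norm of a block diagonal matrix is the larger norm of the two blocks. -/
lemma cstarMatrix_norm_fromBlocks_le {m' n' : Type*} [Fintype m'] [Fintype n']
    (M : Matrix m n A) (N : Matrix m' n' A) {r : ℝ}
    (hM : ‖CStarMatrix.ofMatrix M‖ ≤ r) (hN : ‖CStarMatrix.ofMatrix N‖ ≤ r) :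
    ‖CStarMatrix.ofMatrix (Matrix.fromBlocks M 0 0 N)‖ ≤ r := by
  -- Star homomorphisms are contractive; the rectangular case reduces to this square one through `M
  -- * Mᴴ`.
  let f : CStarMatrix m m A × CStarMatrix m' m' A →⋆ₙₐ[ℂ] CStarMatrix (m ⊕ m') (m ⊕ m') A :=
    { toFun := fun a => CStarMatrix.ofMatrix (Matrix.fromBlocks (CStarMatrix.ofMatrix.symm a.1)
        0 0 (CStarMatrix.ofMatrix.symm a.2))
      map_smul' := fun c a => by ext (i | i) (j | j) <;> simp
      map_zero' := by ext (i | i) (j | j) <;> simp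
      map_add' := fun a b => by ext (i | i) (j | j) <;> simp
      map_mul' := fun a b => by
        ext (i | i) (j | j) <;> simp [CStarMatrix.mul_apply, Matrix.fromBlocks]
      map_star' := fun a => by
        ext (i | i) (j | j) <;> simp [CStarMatrix.star_apply, Matrix.fromBlocks] }
  have hr : 0 ≤ r := (norm_nonneg _).trans hM
  refine le_of_sq_le_sq ?_ hr
  rw [← cstarMatrix_norm_mul_conjTranspose]
  have h1 : CStarMatrix.ofMatrix (Matrix.fromBlocks M 0 0 N) *
      (CStarMatrix.ofMatrix (Matrix.fromBlocks M 0 0 N)).conjTranspose =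
      f (CStarMatrix.ofMatrix M * (CStarMatrix.ofMatrix M).conjTranspose,
        CStarMatrix.ofMatrix N * (CStarMatrix.ofMatrix N).conjTranspose) := by
    ext (i | i) (j | j) <;> simp [CStarMatrix.mul_apply, Matrix.fromBlocks, f]
  rw [h1]
  refine (NonUnitalStarAlgHom.norm_apply_le f _).trans ?_
  rw [Prod.norm_def, cstarMatrix_norm_mul_conjTranspose, cstarMatrix_norm_mul_conjTranspose]
  exact max_le (by gcongr) (by gcongr)

end RectangularMatrices

/-! ### Semicontinuity of matrix norms over a continuous field -/

section ContinuousFields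

variable {X : Type*} [TopologicalSpace X]

lemma toFibre_smul {E : Type*} [AddCommGroup E] [Module C(X, ℂ) E] {y : X} {g : C(X, ℂ)}
    (hg : g y = 1) (e : E) : toFibre y (g • e) = toFibre y e := by
  refine (Submodule.Quotient.eq _).2 ?_
  have h : g • e - e = (g - 1) • e := by rw [sub_smul, one_smul]
  rw [h]
  refine Submodule.smul_mem_smul ?_ Submodule.mem_top
  change (g - 1) y = 0
  simp [hg]

variable [CompactSpace X]
variable {A : Type*} [CStarAlgebra A]
  [Algebra C(X, ℂ) A] [IsScalarTower ℂ C(X, ℂ) A] [StarModule C(X, ℂ) A]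

lemma norm_smul_le_of_starModule (g : C(X, ℂ)) (a : A) : ‖g • a‖ ≤ ‖g‖ * ‖a‖ := by
  let f : C(X, ℂ) →⋆ₐ[ℂ] A :=
    { IsScalarTower.toAlgHom ℂ C(X, ℂ) A with
      map_star' := fun g => by
        simp [Algebra.algebraMap_eq_smul_one, star_smul] }
  rw [Algebra.smul_def]
  refine (norm_mul_le _ _).trans ?_
  gcongr
  exact NonUnitalStarAlgHom.norm_apply_le f g

/-- The norm of the fibre of a `C(X)`-algebra is the local seminorm. -/
lemma localSeminorm_eq_norm_toFibre (y : X) (a : A) :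
    localSeminorm (normSeminorm ℂ A) (norm_smul_le_of_starModule (X := X)) y a = ‖toFibre y a‖ := by
  apply le_antisymm
  · refine le_of_forall_pos_le_add fun ε hε => ?_
    obtain ⟨b, hb, hbε⟩ := Submodule.Quotient.norm_mk_lt (toFibre y a) hε
    have hmem : a - b ∈ (vanishingIdeal y • ⊤ : Submodule C(X, ℂ) A) := by
      rw [← Submodule.Quotient.eq]
      exact hb.symm
    have hzero : localSeminorm (normSeminorm ℂ A) (norm_smul_le_of_starModule (X := X)) y
        (a - b) ≤ 0 := by
      refine Submodule.smul_induction_on hmem (fun f hf c _ => ?_) fun c d hc hd => ?_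
      · exact (localSeminorm_smul_eq_zero hf c).le
      · exact (map_add_le_add _ _ _).trans (add_nonpos hc hd)
    calc _ = localSeminorm (normSeminorm ℂ A) (norm_smul_le_of_starModule (X := X)) y
          (b + (a - b)) := by rw [add_sub_cancel]
      _ ≤ _ := map_add_le_add _ _ _
      _ ≤ ‖b‖ + 0 := add_le_add (localSeminorm_le b) hzero
      _ ≤ _ := by rw [add_zero]; exact hbε.le
  · refine le_localSeminorm fun g hg => ?_
    rw [← toFibre_smul hg.2]
    exact Submodule.Quotient.norm_mk_le _ _

variable [PartialOrder A] [StarOrderedRing A] {m n : Type*} [Fintype m] [Fintype n]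

/-- The C⋆-identity moves the estimate to `M * Mᴴ`, in the square matrices, which are again a
`C(X)`-algebra. -/
lemma cstarMatrix_norm_smul_le (g : C(X, ℂ)) (M : CStarMatrix m n A) : ‖g • M‖ ≤ ‖g‖ * ‖M‖ := by
  classical
  refine le_of_sq_le_sq ?_ (by positivity)
  have h : (g • M) * (g • M).conjTranspose = (g * star g) • (M * M.conjTranspose) := by
    ext i j
    simp [CStarMatrix.mul_apply, Finset.smul_sum, star_smul, smul_smul, mul_comm]
  rw [← cstarMatrix_norm_mul_conjTranspose, h, mul_pow, ← cstarMatrix_norm_mul_conjTranspose]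
  refine (norm_smul_le_of_starModule _ _).trans ?_
  rw [CStarRing.norm_self_mul_star, sq]

variable (A m n) in
/-- The norm of matrices over a `C(X)`-algebra, localised at a point. -/
def cstarMatrixLocalSeminorm (y : X) : Seminorm ℂ (CStarMatrix m n A) :=
  localSeminorm (normSeminorm ℂ (CStarMatrix m n A)) (cstarMatrix_norm_smul_le (X := X)) y

/-- The C⋆-identity descends to fibres because `star g * g` is a peak function whenever `g` is one.
-/
lemma cstarMatrixLocalSeminorm_mul_conjTranspose (y : X) (M : CStarMatrix m n A) :
    cstarMatrixLocalSeminorm A m m y (M * M.conjTranspose) =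
      cstarMatrixLocalSeminorm A m n y M ^ 2 := by
  have h (g : C(X, ℂ)) :
      (g • M) * (g • M).conjTranspose = (star g * g) • (M * M.conjTranspose) := by
    ext i j
    simp [CStarMatrix.mul_apply, Finset.smul_sum, star_smul, smul_smul, mul_comm]
  apply le_antisymm
  · rw [← Real.sqrt_le_left (apply_nonneg _ _)]
    refine le_localSeminorm fun g hg => ?_
    rw [Real.sqrt_le_left (apply_nonneg _ _)]
    change _ ≤ ‖g • M‖ ^ 2
    rw [← cstarMatrix_norm_mul_conjTranspose, h]
    exact localSeminorm_le_smul (mul_mem_peakFunctions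
      ⟨by rw [norm_star]; exact hg.1, by simp [hg.2]⟩ hg) _
  · refine le_localSeminorm fun g hg => ?_
    calc _ ≤ ‖g • M‖ ^ 2 := by
          gcongr
          exact localSeminorm_le_smul hg M
      _ = ‖star g • g • (M * M.conjTranspose)‖ := by
          rw [← cstarMatrix_norm_mul_conjTranspose, h, mul_smul]
      _ ≤ ‖star g‖ * ‖g • (M * M.conjTranspose)‖ := cstarMatrix_norm_smul_le _ _
      _ ≤ ‖g • (M * M.conjTranspose)‖ := by
          rw [norm_star]
          exact mul_le_of_le_one_left (norm_nonneg _) hg.1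

lemma localSeminorm_entry_le (y : X) (M : CStarMatrix m n A) (i : m) (j : n) :
    localSeminorm (normSeminorm ℂ A) (norm_smul_le_of_starModule (X := X)) y (M i j) ≤
      cstarMatrixLocalSeminorm A m n y M :=
  le_localSeminorm fun g hg => (localSeminorm_le_smul hg _).trans
    (CStarMatrix.norm_entry_le_norm (M := g • M) (i := i) (j := j))

lemma cstarMatrixLocalSeminorm_le_sum (y : X) (M : CStarMatrix m n A) :
    cstarMatrixLocalSeminorm A m n y M ≤ ∑ i, ∑ j,
      localSeminorm (normSeminorm ℂ A) (norm_smul_le_of_starModule (X := X)) y (M i j) := by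
  classical
  have hM : M = ∑ i, ∑ j, CStarMatrix.ofMatrix (Matrix.single i j (M i j)) :=
    Matrix.matrix_eq_sum_single (α := A) M
  conv_lhs => rw [hM]
  refine (Finset.le_sum_of_subadditive _ (map_zero _).le (map_add_le_add _) _ _).trans
    (Finset.sum_le_sum fun i _ => ?_)
  refine (Finset.le_sum_of_subadditive _ (map_zero _).le (map_add_le_add _) _ _).trans
    (Finset.sum_le_sum fun j _ => le_localSeminorm fun g hg => ?_)
  refine (localSeminorm_le_smul hg _).trans ((cstarMatrix_norm_le_sum _).trans (le_of_eq ?_))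
  simp only [CStarMatrix.smul_apply, CStarMatrix.ofMatrix_apply, Matrix.single_apply, smul_ite,
    smul_zero, apply_ite norm, norm_zero, ite_and]
  simp

/-- The local norms of matrices over a continuous `C(X)`-algebra are lower semicontinuous. -/
lemma lowerSemicontinuous_cstarMatrixLocalSeminorm (hA : IsContinuousField X A)
    (M : CStarMatrix m n A) :
    LowerSemicontinuous fun y : X => cstarMatrixLocalSeminorm A m n y M := by
  have hpow (j : ℕ) : ∃ b : CStarMatrix m m A, ∀ y : X,
      cstarMatrixLocalSeminorm A m m y b = cstarMatrixLocalSeminorm A m n y M ^ 2 ^ (j + 1) := by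
    induction j with
    | zero => exact ⟨M * M.conjTranspose, fun y => by
        simp [cstarMatrixLocalSeminorm_mul_conjTranspose]⟩
    | succ j ih =>
      obtain ⟨b, hb⟩ := ih
      exact ⟨b * b.conjTranspose, fun y => by
        rw [cstarMatrixLocalSeminorm_mul_conjTranspose, hb, ← pow_mul, ← pow_succ]⟩
  intro y₀ c hc
  rcases lt_or_ge c 0 with hc0 | hc0
  · exact Eventually.of_forall fun y => hc0.trans_le (apply_nonneg _ _)
  set a := cstarMatrixLocalSeminorm A m n y₀ M with ha
  have ha0 : 0 < a := hc0.trans_lt hc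
  set K : ℝ := (Fintype.card m : ℝ) * Fintype.card m with hK
  -- `K` is the loss in comparing the matrix norm with the entries. Since `c < a`, a high enough
  -- power outweighs it.
  obtain ⟨j, hj⟩ : ∃ j : ℕ, K * c ^ 2 ^ (j + 1) < a ^ 2 ^ (j + 1) := by
    have h1 : Tendsto (fun j : ℕ => K * (c / a) ^ 2 ^ (j + 1)) atTop (𝓝 (K * 0)) := by
      refine ((tendsto_pow_atTop_nhds_zero_of_lt_one (by positivity)
        ((div_lt_one ha0).2 hc)).comp ?_).const_mul K
      exact (tendsto_pow_atTop_atTop_of_one_lt one_lt_two).comp (tendsto_add_atTop_nat 1)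
    rw [mul_zero] at h1
    obtain ⟨j, hj⟩ := (h1.eventually_lt_const zero_lt_one).exists
    refine ⟨j, ?_⟩
    rwa [div_pow, mul_div_assoc', div_lt_one (by positivity)] at hj
  obtain ⟨b, hb⟩ := hpow j
  have hcont : Continuous fun y : X => ∑ i, ∑ i', ‖toFibre y (b i i')‖ :=
    continuous_finsetSum _ fun i _ => continuous_finsetSum _ fun i' _ => hA _
  have h0 : K * c ^ 2 ^ (j + 1) < ∑ i, ∑ i', ‖toFibre y₀ (b i i')‖ := by
    refine hj.trans_le ?_
    rw [ha, ← hb]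
    simpa only [localSeminorm_eq_norm_toFibre] using cstarMatrixLocalSeminorm_le_sum y₀ b
  filter_upwards [hcont.continuousAt.eventually_const_lt h0] with y hy
  by_contra! hcon
  refine absurd hy (not_lt.2 ?_)
  calc ∑ i, ∑ i', ‖toFibre y (b i i')‖ ≤ ∑ _i : m, ∑ _i' : m, c ^ 2 ^ (j + 1) := by
        gcongr with i _ i' _
        rw [← localSeminorm_eq_norm_toFibre]
        refine (localSeminorm_entry_le y b i i').trans ?_
        rw [hb]
        have := apply_nonneg (cstarMatrixLocalSeminorm A m n y) M
        gcongr
    _ = K * c ^ 2 ^ (j + 1) := by simp [hK, mul_assoc]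

end ContinuousFields

/-! ### Scalar compressions and Hilbert-Schmidt norms -/

section Sandwich

variable {m n : Type*} [Fintype m] [Fintype n]
variable {W : Type*} [AddCommGroup W] [Module ℂ W]

/-- The product `ξᴴ w η` of a matrix `w` over a vector space with scalar matrices. -/
def sandwich {k l : Type*} (ξ : Matrix m k ℂ) (η : Matrix n l ℂ) (w : Matrix m n W) :
    Matrix k l W :=
  Matrix.of fun i j => ∑ a, ∑ b, (star (ξ a i) * η b j) • w a b

lemma sandwich_apply {k l : Type*} (ξ : Matrix m k ℂ) (η : Matrix n l ℂ) (w : Matrix m n W)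
    (i : k) (j : l) :
    sandwich ξ η w i j = ∑ a, ∑ b, (star (ξ a i) * η b j) • w a b := rfl

lemma sandwich_sandwich {k l m' n' : Type*} [Fintype k] [Fintype l] (ξ : Matrix m k ℂ)
    (η : Matrix n l ℂ) (α : Matrix k m' ℂ) (β : Matrix l n' ℂ) (w : Matrix m n W) :
    sandwich α β (sandwich ξ η w) = sandwich (ξ * α) (η * β) w := by
  ext i j
  calc sandwich α β (sandwich ξ η w) i j = ∑ i', ∑ j', ∑ a, ∑ b,
        (star (α i' i) * β j' j * (star (ξ a i') * η b j')) • w a b := by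
        simp only [sandwich_apply, Finset.smul_sum, smul_smul]
    _ = ∑ i', ∑ a, ∑ j', ∑ b, (star (α i' i) * β j' j * (star (ξ a i') * η b j')) • w a b :=
        Finset.sum_congr rfl fun i' _ => Finset.sum_comm
    _ = ∑ a, ∑ i', ∑ j', ∑ b, (star (α i' i) * β j' j * (star (ξ a i') * η b j')) • w a b :=
        Finset.sum_comm
    _ = ∑ a, ∑ i', ∑ b, ∑ j', (star (α i' i) * β j' j * (star (ξ a i') * η b j')) • w a b :=
        Finset.sum_congr rfl fun a _ => Finset.sum_congr rfl fun i' _ => Finset.sum_comm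
    _ = ∑ a, ∑ b, ∑ i', ∑ j', (star (α i' i) * β j' j * (star (ξ a i') * η b j')) • w a b :=
        Finset.sum_congr rfl fun a _ => Finset.sum_comm
    _ = sandwich (ξ * α) (η * β) w i j := by
        simp only [sandwich_apply, Matrix.mul_apply, star_sum, star_mul', Finset.sum_mul_sum,
          Finset.sum_smul]
        refine Finset.sum_congr rfl fun a _ => Finset.sum_congr rfl fun b _ =>
          Finset.sum_congr rfl fun i' _ => Finset.sum_congr rfl fun j' _ => ?_
        congr 1
        ring

lemma sandwich_one [DecidableEq m] [DecidableEq n] (w : Matrix m n W) :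
    sandwich (1 : Matrix m m ℂ) (1 : Matrix n n ℂ) w = w := by
  ext i j
  simp [sandwich_apply, Matrix.one_apply, apply_ite star, ite_smul]

lemma sandwich_smul {k l R : Type*} [Monoid R] [DistribMulAction R W] [SMulCommClass R ℂ W]
    (ξ : Matrix m k ℂ) (η : Matrix n l ℂ) (g : R) (w : Matrix m n W) :
    sandwich ξ η (g • w) = g • sandwich ξ η w := by
  ext i j
  simp only [sandwich_apply, Matrix.smul_apply, Finset.smul_sum, smul_comm]

lemma smul_sandwich_smul {k l : Type*} (ξ : Matrix m k ℂ) (η : Matrix n l ℂ) (c d : ℂ)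
    (w : Matrix m n W) : sandwich (c • ξ) (d • η) w = (star c * d) • sandwich ξ η w := by
  ext i j
  simp only [sandwich_apply, Matrix.smul_apply, Finset.smul_sum, smul_smul, smul_eq_mul, star_mul']
  refine Finset.sum_congr rfl fun a _ => Finset.sum_congr rfl fun b _ => ?_
  congr 1
  ring

lemma sandwich_fromRows {k l m' n' : Type*} [Fintype m'] [Fintype n'] (ξ : Matrix m k ℂ)
    (ξ' : Matrix m' k ℂ) (η : Matrix n l ℂ) (η' : Matrix n' l ℂ) (w : Matrix m n W)
    (w' : Matrix m' n' W) :
    sandwich (Matrix.fromRows ξ ξ') (Matrix.fromRows η η') (Matrix.fromBlocks w 0 0 w') =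
      sandwich ξ η w + sandwich ξ' η' w' := by
  ext i j
  simp [sandwich_apply, Fintype.sum_sum_type]

/-- The square of the Hilbert-Schmidt norm. -/
def hsNormSq {k : Type*} [Fintype k] (ξ : Matrix m k ℂ) : ℝ := ∑ i, ∑ j, ‖ξ i j‖ ^ 2

lemma hsNormSq_nonneg {k : Type*} [Fintype k] (ξ : Matrix m k ℂ) : 0 ≤ hsNormSq ξ :=
  Finset.sum_nonneg fun _ _ => Finset.sum_nonneg fun _ _ => by positivity

lemma hsNormSq_smul {k : Type*} [Fintype k] (c : ℂ) (ξ : Matrix m k ℂ) :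
    hsNormSq (c • ξ) = ‖c‖ ^ 2 * hsNormSq ξ := by
  simp [hsNormSq, Finset.mul_sum, mul_pow]

lemma hsNormSq_fromRows {k m' : Type*} [Fintype k] [Fintype m'] (ξ : Matrix m k ℂ)
    (ξ' : Matrix m' k ℂ) : hsNormSq (Matrix.fromRows ξ ξ') = hsNormSq ξ + hsNormSq ξ' := by
  simp [hsNormSq, Fintype.sum_sum_type]

lemma conjTranspose_mul_self_apply_self {k : Type*} (ξ : Matrix m k ℂ) (j : k) :
    (ξᴴ * ξ) j j = ((∑ i, ‖ξ i j‖ ^ 2 : ℝ) : ℂ) := by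
  simp [Matrix.mul_apply, ← Complex.conj_mul']

lemma trace_conjTranspose_mul_self {k : Type*} [Fintype k] (ξ : Matrix m k ℂ) :
    (ξᴴ * ξ).trace = (hsNormSq ξ : ℂ) := by
  rw [hsNormSq, Finset.sum_comm, Matrix.trace, Complex.ofReal_sum]
  exact Finset.sum_congr rfl fun j _ => conjTranspose_mul_self_apply_self ξ j

/-- A scalar matrix factors as a contraction times an invertible square matrix, of almost the same
Hilbert-Schmidt norm and with control of the inverse. -/
lemma exists_contraction_mul_eq {k : Type*} [Fintype k] [DecidableEq k] (ξ : Matrix m k ℂ) {δ : ℝ}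
    (hδ : 0 < δ) :
    ∃ α α' D : Matrix k k ℂ, α' * α = 1 ∧
      (ξ * α')ᴴ * (ξ * α') + Dᴴ * D = 1 ∧ hsNormSq α = hsNormSq ξ + δ * Fintype.card k ∧
      ∀ i j, ‖α' i j‖ ^ 2 ≤ δ⁻¹ := by
  -- A perturbed polar decomposition, with `αᴴ * α = ξᴴ * ξ + δ`: the shift makes `α` invertible and
  -- bounds its inverse, and `√δ • α⁻¹` completes the contraction `ξ * α⁻¹` to an isometry.
  have hpos : (ξᴴ * ξ + (δ : ℂ) • (1 : Matrix k k ℂ)).PosDef := by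
    refine Matrix.PosDef.posSemidef_add (Matrix.posSemidef_conjTranspose_mul_self ξ) ?_
    exact Matrix.PosDef.one.smul (by exact_mod_cast hδ)
  obtain ⟨α, hα⟩ : ∃ α : Matrix k k ℂ, ξᴴ * ξ + (δ : ℂ) • (1 : Matrix k k ℂ) = αᴴ * α := by
    open scoped MatrixOrder in
    exact CStarAlgebra.nonneg_iff_eq_star_mul_self.1 hpos.posSemidef.nonneg
  have hunit : IsUnit α := by
    have h := hpos.isUnit
    rw [hα, Matrix.isUnit_iff_isUnit_det, Matrix.det_mul] at h
    exact (Matrix.isUnit_iff_isUnit_det _).2 (isUnit_of_mul_isUnit_right h)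
  have h1 : α * α⁻¹ = 1 := Matrix.mul_nonsing_inv _ ((Matrix.isUnit_iff_isUnit_det _).1 hunit)
  have h2 : α⁻¹ * α = 1 := Matrix.nonsing_inv_mul _ ((Matrix.isUnit_iff_isUnit_det _).1 hunit)
  have hsq : star (Real.sqrt δ : ℂ) * (Real.sqrt δ : ℂ) = δ := by
    rw [Complex.star_def, Complex.conj_ofReal, ← Complex.ofReal_mul, Real.mul_self_sqrt hδ.le]
  have h3 : (ξ * α⁻¹)ᴴ * (ξ * α⁻¹) + ((Real.sqrt δ : ℂ) • α⁻¹)ᴴ *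
      ((Real.sqrt δ : ℂ) • α⁻¹) = 1 := by
    calc _ = (α⁻¹)ᴴ * (ξᴴ * ξ + (δ : ℂ) • (1 : Matrix k k ℂ)) * α⁻¹ := by
          rw [Matrix.conjTranspose_mul, Matrix.conjTranspose_smul, Matrix.smul_mul,
            Matrix.mul_smul, smul_smul, hsq, Matrix.mul_add, Matrix.add_mul, Matrix.mul_smul,
            Matrix.mul_one, Matrix.smul_mul]
          simp only [Matrix.mul_assoc]
      _ = (α * α⁻¹)ᴴ * (α * α⁻¹) := by
          rw [hα, Matrix.conjTranspose_mul]
          simp only [Matrix.mul_assoc]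
      _ = 1 := by simp [h1]
  refine ⟨α, α⁻¹, (Real.sqrt δ : ℂ) • α⁻¹, h2, h3, ?_, fun i j => ?_⟩
  · have := congrArg Matrix.trace hα
    rw [Matrix.trace_add, Matrix.trace_smul, Matrix.trace_one, trace_conjTranspose_mul_self,
      trace_conjTranspose_mul_self, smul_eq_mul] at this
    exact_mod_cast this.symm
  · have := congrFun (congrFun h3 j) j
    rw [Matrix.add_apply, conjTranspose_mul_self_apply_self, conjTranspose_mul_self_apply_self,
      Matrix.one_apply_eq] at this
    have h4 : (∑ i, ‖(ξ * α⁻¹) i j‖ ^ 2) + ∑ i, ‖((Real.sqrt δ : ℂ) • α⁻¹) i j‖ ^ 2 = 1 := by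
      exact_mod_cast this
    have h5 : 0 ≤ ∑ i, ‖(ξ * α⁻¹) i j‖ ^ 2 := by positivity
    have h6 : ‖((Real.sqrt δ : ℂ) • α⁻¹) i j‖ ^ 2 ≤ ∑ i, ‖((Real.sqrt δ : ℂ) • α⁻¹) i j‖ ^ 2 :=
      Finset.single_le_sum (f := fun i => ‖((Real.sqrt δ : ℂ) • α⁻¹) i j‖ ^ 2)
        (fun _ _ => by positivity) (Finset.mem_univ i)
    have h7 : ‖((Real.sqrt δ : ℂ) • α⁻¹) i j‖ ^ 2 = δ * ‖α⁻¹ i j‖ ^ 2 := by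
      rw [Matrix.smul_apply, norm_smul, mul_pow, Complex.norm_real, Real.norm_of_nonneg
        (Real.sqrt_nonneg _), Real.sq_sqrt hδ.le]
    rw [← one_div δ, le_div_iff₀ hδ]
    linarith

end Sandwich

/-! ### Matrix norms on the submodule -/

section MatrixSeminorm

variable {X : Type*} [TopologicalSpace X] [CompactSpace X]
variable {A : Type*} [CStarAlgebra A] [PartialOrder A] [StarOrderedRing A]

/-- A scalar contraction is a contraction over every C⋆-algebra. -/
lemma norm_map_algebraMap_le_one {m k o : Type*} [Fintype m] [Fintype k] [Fintype o]
    [DecidableEq k] (u : Matrix m k ℂ) (D : Matrix o k ℂ) (h : uᴴ * u + Dᴴ * D = 1) :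
    ‖CStarMatrix.ofMatrix (u.map (algebraMap ℂ A))‖ ≤ 1 := by
  rw [← cstarMatrix_norm_conjTranspose]
  refine cstarMatrix_norm_le_one _
    (CStarMatrix.ofMatrix (D.map (algebraMap ℂ A))).conjTranspose ?_
  ext i j
  have hij := congrArg (algebraMap ℂ A) (congrFun (congrFun h i) j)
  simp only [Matrix.add_apply, Matrix.mul_apply, Matrix.conjTranspose_apply, map_add, map_sum,
    map_mul, Matrix.one_apply, apply_ite (algebraMap ℂ A), map_one, map_zero] at hij
  simpa [CStarMatrix.mul_apply, CStarMatrix.one_apply, ← algebraMap_star_comm] using hij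

variable [Algebra C(X, ℂ) A] [IsScalarTower ℂ C(X, ℂ) A] (V : Submodule C(X, ℂ) A)
variable {m n : Type*} [Fintype m] [Fintype n]

variable (m n) in
/-- The inclusion of `M_{m,n}(V)` in `M_{m,n}(A)`. -/
def toCStarMatrix : Matrix m n V →ₗ[ℂ] CStarMatrix m n A where
  toFun w := CStarMatrix.ofMatrix (w.map fun a : V => (a : A))
  map_add' _ _ := rfl
  map_smul' _ _ := rfl

variable (m n) in
/-- The norm of `M_{m,n}(V)` inherited from `M_{m,n}(A)`. -/
def matSeminorm : Seminorm ℂ (Matrix m n V) :=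
  (normSeminorm ℂ (CStarMatrix m n A)).comp (toCStarMatrix V m n)

lemma matSeminorm_apply (w : Matrix m n V) :
    matSeminorm V m n w = ‖CStarMatrix.ofMatrix (w.map fun a : V => (a : A))‖ := rfl

/-- Contractivity of `u` and `v` is expressed by the complements `D` and `D'`, an algebraic identity
that transfers from `ℂ` to `A`. -/
lemma matSeminorm_sandwich_le {k l o o' : Type*} [Fintype k] [Fintype l] [Fintype o]
    [Fintype o'] [DecidableEq k] [DecidableEq l] (u : Matrix m k ℂ) (D : Matrix o k ℂ)
    (hu : uᴴ * u + Dᴴ * D = 1) (v : Matrix n l ℂ) (D' : Matrix o' l ℂ)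
    (hv : vᴴ * v + D'ᴴ * D' = 1) (w : Matrix m n V) :
    matSeminorm V k l (sandwich u v w) ≤ matSeminorm V m n w := by
  have h : CStarMatrix.ofMatrix ((sandwich u v w).map fun a : V => (a : A)) =
      (CStarMatrix.ofMatrix (u.map (algebraMap ℂ A))).conjTranspose *
        (CStarMatrix.ofMatrix (w.map fun a : V => (a : A)) *
          CStarMatrix.ofMatrix (v.map (algebraMap ℂ A))) := by
    ext i j
    simp only [CStarMatrix.ofMatrix_apply, CStarMatrix.mul_apply, CStarMatrix.conjTranspose_apply,
      Matrix.map_apply, sandwich_apply, Finset.mul_sum, ← algebraMap_star_comm,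
      Submodule.coe_sum]
    refine Finset.sum_congr rfl fun a _ => Finset.sum_congr rfl fun b _ => ?_
    rw [← Algebra.commutes (v b j), ← mul_assoc, ← map_mul, ← Algebra.smul_def]
    rfl
  rw [matSeminorm_apply, h, matSeminorm_apply]
  calc _ ≤ 1 * (‖CStarMatrix.ofMatrix (w.map fun a : V => (a : A))‖ * 1) := by
        refine (cstarMatrix_norm_mul_le _ _).trans ?_
        rw [cstarMatrix_norm_conjTranspose]
        gcongr
        · exact norm_map_algebraMap_le_one u D hu
        · refine (cstarMatrix_norm_mul_le _ _).trans ?_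
          gcongr
          exact norm_map_algebraMap_le_one v D' hv
    _ = _ := by ring

lemma matSeminorm_le_sum (w : Matrix m n V) : matSeminorm V m n w ≤ ∑ i, ∑ j, ‖w i j‖ :=
  cstarMatrix_norm_le_sum _

lemma matSeminorm_fromBlocks_le {m' n' : Type*} [Fintype m'] [Fintype n'] {w : Matrix m n V}
    {w' : Matrix m' n' V} {r : ℝ} (hw : matSeminorm V m n w ≤ r)
    (hw' : matSeminorm V m' n' w' ≤ r) :
    matSeminorm V (m ⊕ m') (n ⊕ n') (Matrix.fromBlocks w 0 0 w') ≤ r := by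
  have h := cstarMatrix_norm_fromBlocks_le _ _ hw hw'
  have h2 : (Matrix.fromBlocks w 0 0 w').map (fun a : V => (a : A)) =
      Matrix.fromBlocks (w.map fun a : V => (a : A)) 0 0 (w'.map fun a : V => (a : A)) := by
    ext (i | i) (j | j) <;> simp
  rw [matSeminorm_apply, h2]
  exact h

lemma matSeminorm_smul_le [StarModule C(X, ℂ) A] (g : C(X, ℂ)) (w : Matrix m n V) :
    matSeminorm V m n (g • w) ≤ ‖g‖ * matSeminorm V m n w :=
  cstarMatrix_norm_smul_le g (toCStarMatrix V m n w)

lemma lowerSemicontinuous_localSeminorm_matSeminorm [StarModule C(X, ℂ) A]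
    (hA : IsContinuousField X A) (w : Matrix m n V) :
    LowerSemicontinuous fun y : X =>
      localSeminorm (matSeminorm V m n) (matSeminorm_smul_le V) y w :=
  lowerSemicontinuous_cstarMatrixLocalSeminorm hA (toCStarMatrix V m n w)

end MatrixSeminorm

/-! ### The projective norm on `M_{k,l}(V)` and its semicontinuity -/

section TraceGauge

variable {X : Type*} [TopologicalSpace X] [CompactSpace X]
variable {A : Type*} [CStarAlgebra A] [Algebra C(X, ℂ) A] [IsScalarTower ℂ C(X, ℂ) A]
  (V : Submodule C(X, ℂ) A)

lemma ofReal_smul_matrix {k l : Type*} (r : ℝ) (z : Matrix k l V) : (r : ℂ) • z = r • z :=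
  algebraMap_smul ℂ r z

variable [PartialOrder A] [StarOrderedRing A] (k l : Type) [Fintype k] [Fintype l]

/-- The unit ball of the operator space projective tensor norm of `M_{k,l}(V)`, whose dual consists
of the completely bounded maps from `V` to the `k × l` matrices. -/
def traceBall : Set (Matrix k l V) :=
  {z | ∃ (m n : Type) (_ : Fintype m) (_ : Fintype n) (ξ : Matrix m k ℂ) (η : Matrix n l ℂ)
    (w : Matrix m n V), hsNormSq ξ ≤ 1 ∧ hsNormSq η ≤ 1 ∧ matSeminorm V m n w ≤ 1 ∧
      z = sandwich ξ η w}

lemma balanced_traceBall : Balanced ℂ (traceBall V k l) := by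
  rintro c hc _ ⟨_, ⟨m, n, _, _, ξ, η, w, hξ, hη, hw, rfl⟩, rfl⟩
  refine ⟨m, n, _, _, ξ, η, c • w, hξ, hη, ?_, (sandwich_smul ξ η c w).symm⟩
  rw [map_smul_eq_mul]
  exact mul_le_one₀ hc (apply_nonneg _ _) hw

/-- Convex combinations are realized by direct sums: the scalar factors are weighted by `√a`, `√b`
and stacked. Hence the unrestricted sizes m and n. -/
lemma convex_traceBall : Convex ℝ (traceBall V k l) := by
  rintro _ ⟨m, n, _, _, ξ, η, w, hξ, hη, hw, rfl⟩ _ ⟨m', n', _, _, ξ', η', w', hξ', hη', hw', rfl⟩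
    a b ha hb hab
  have hs {k₁ m₁ m₂ : Type} [Fintype k₁] [Fintype m₁] [Fintype m₂] {ξ : Matrix m₁ k₁ ℂ}
      {ξ' : Matrix m₂ k₁ ℂ} (h : hsNormSq ξ ≤ 1) (h' : hsNormSq ξ' ≤ 1) :
      hsNormSq (Matrix.fromRows ((Real.sqrt a : ℂ) • ξ) ((Real.sqrt b : ℂ) • ξ')) ≤ 1 := by
    rw [hsNormSq_fromRows, hsNormSq_smul, hsNormSq_smul, Complex.norm_real, Complex.norm_real,
      Real.norm_of_nonneg (Real.sqrt_nonneg _), Real.norm_of_nonneg (Real.sqrt_nonneg _),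
      Real.sq_sqrt ha, Real.sq_sqrt hb, ← hab]
    nlinarith
  refine ⟨m ⊕ m', n ⊕ n', _, _, _, _, _, hs hξ hξ', hs hη hη',
    matSeminorm_fromBlocks_le V hw hw', ?_⟩
  have hsq {c : ℝ} (hc : 0 ≤ c) : star (Real.sqrt c : ℂ) * (Real.sqrt c : ℂ) = c := by
    rw [Complex.star_def, Complex.conj_ofReal, ← Complex.ofReal_mul, Real.mul_self_sqrt hc]
  rw [sandwich_fromRows, smul_sandwich_smul, smul_sandwich_smul, hsq ha, hsq hb]
  rw [ofReal_smul_matrix, ofReal_smul_matrix]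

variable {k l} in
lemma sandwich_mem_smul_traceBall {m n : Type} [Fintype m] [Fintype n] {ξ : Matrix m k ℂ}
    {η : Matrix n l ℂ} {w : Matrix m n V} {c r : ℝ} (hc : 0 < c) (hr : 0 < r)
    (hξ : hsNormSq ξ ≤ c) (hη : hsNormSq η ≤ c) (hw : matSeminorm V m n w ≤ r) :
    sandwich ξ η w ∈ (c * r) • traceBall V k l := by
  have hs {k₁ m₁ : Type} [Fintype k₁] [Fintype m₁] {ξ : Matrix m₁ k₁ ℂ} (h : hsNormSq ξ ≤ c) :
      hsNormSq ((((Real.sqrt c)⁻¹ : ℝ) : ℂ) • ξ) ≤ 1 := by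
    rw [hsNormSq_smul, Complex.norm_real, Real.norm_of_nonneg (by positivity), inv_pow,
      Real.sq_sqrt hc.le, inv_mul_le_iff₀ hc, mul_one]
    exact h
  refine ⟨_, ⟨m, n, _, _, _, _, ((r⁻¹ : ℝ) : ℂ) • w, hs hξ, hs hη, ?_, rfl⟩, ?_⟩
  · rw [map_smul_eq_mul, Complex.norm_real, Real.norm_of_nonneg (by positivity),
      inv_mul_le_iff₀ hr, mul_one]
    exact hw
  · have h1 : star (((Real.sqrt c)⁻¹ : ℝ) : ℂ) * (((Real.sqrt c)⁻¹ : ℝ) : ℂ) = ((c⁻¹ : ℝ) : ℂ) := by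
      rw [Complex.star_def, Complex.conj_ofReal, ← Complex.ofReal_mul, ← mul_inv,
        Real.mul_self_sqrt hc.le]
    dsimp only
    rw [smul_sandwich_smul, h1, sandwich_smul, ofReal_smul_matrix, ofReal_smul_matrix, smul_smul,
      smul_smul]
    rw [show c * r * c⁻¹ * r⁻¹ = 1 by field_simp, one_smul]

lemma absorbent_traceBall : Absorbent ℝ (traceBall V k l) := by
  classical
  intro z
  set c : ℝ := max (hsNormSq (1 : Matrix k k ℂ)) (hsNormSq (1 : Matrix l l ℂ)) + 1
  set r : ℝ := matSeminorm V k l z + 1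
  have hc : 0 < c := by
    have := (hsNormSq_nonneg (1 : Matrix k k ℂ)).trans (le_max_left _ (hsNormSq (1 : Matrix l l ℂ)))
    positivity
  have hr : 0 < r := by positivity
  have hmem := sandwich_mem_smul_traceBall V (ξ := (1 : Matrix k k ℂ)) (η := (1 : Matrix l l ℂ))
    (w := z) hc hr ((le_max_left _ _).trans (lt_add_one _).le)
    ((le_max_right _ _).trans (lt_add_one _).le) (lt_add_one _).le
  rw [sandwich_one] at hmem
  obtain ⟨z', hz', hzz'⟩ := hmem
  refine absorbs_iff_norm.2 ⟨c * r, fun d hd => ?_⟩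
  rintro _ rfl
  have hd0 : 0 < ‖d‖ := (by positivity : 0 < c * r).trans_le hd
  have hdne : d ≠ 0 := norm_pos_iff.1 hd0
  refine ⟨((c * r / d : ℝ) : ℂ) • z', balanced_traceBall V k l _ ?_ ⟨z', hz', rfl⟩, ?_⟩
  · rw [Complex.norm_real, norm_div, Real.norm_of_nonneg (by positivity : 0 ≤ c * r)]
    exact (div_le_one hd0).2 hd
  · dsimp only at hzz' ⊢
    rw [ofReal_smul_matrix, smul_smul, mul_div_cancel₀ _ hdne, hzz']

/-- The operator space projective tensor norm of `M_{k,l}(V)`. -/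
def traceSeminorm : Seminorm ℂ (Matrix k l V) :=
  gaugeSeminorm (balanced_traceBall V k l) (convex_traceBall V k l) (absorbent_traceBall V k l)

variable {k l}

lemma traceSeminorm_apply (z : Matrix k l V) :
    traceSeminorm V k l z = gauge (traceBall V k l) z := rfl

lemma traceSeminorm_sandwich_le {m n : Type} [Fintype m] [Fintype n] {ξ : Matrix m k ℂ}
    {η : Matrix n l ℂ} {c : ℝ} (hc : 0 < c) (hξ : hsNormSq ξ ≤ c) (hη : hsNormSq η ≤ c)
    (w : Matrix m n V) : traceSeminorm V k l (sandwich ξ η w) ≤ c * matSeminorm V m n w := by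
  refine le_of_forall_pos_le_add fun ε hε => ?_
  have hr : 0 < matSeminorm V m n w + ε / c := by positivity
  have hmem := sandwich_mem_smul_traceBall V hc hr hξ hη (le_add_of_nonneg_right (by positivity))
  rw [mul_add, mul_div_cancel₀ _ hc.ne'] at hmem
  rw [traceSeminorm_apply]
  exact gauge_le_of_mem (by positivity) hmem

lemma exists_sandwich_of_traceSeminorm_lt {z : Matrix k l V} {r : ℝ}
    (h : traceSeminorm V k l z < r) :
    ∃ (m n : Type) (_ : Fintype m) (_ : Fintype n) (ξ : Matrix m k ℂ) (η : Matrix n l ℂ)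
      (w : Matrix m n V), hsNormSq ξ ≤ 1 ∧ hsNormSq η ≤ 1 ∧ matSeminorm V m n w < r ∧
        z = sandwich ξ η w := by
  rw [traceSeminorm_apply, gauge_def] at h
  obtain ⟨s, ⟨hs, hmem⟩, hsr⟩ := exists_lt_of_csInf_lt
    (Absorbent.gauge_set_nonempty (E := Matrix k l V) (absorbent_traceBall V k l)) h
  obtain ⟨z', hz'', hz⟩ := Set.mem_smul_set.1 hmem
  obtain ⟨m, n, hm, hn, ξ, η, w, hξ, hη, hw, hz'⟩ := hz''
  refine ⟨m, n, hm, hn, ξ, η, (s : ℂ) • w, hξ, hη, ?_, ?_⟩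
  · rw [map_smul_eq_mul, Complex.norm_real, Real.norm_of_nonneg hs.le]
    exact (mul_le_of_le_one_right hs.le hw).trans_lt hsr
  · rw [sandwich_smul, ofReal_smul_matrix, ← hz']
    exact hz.symm

lemma traceSeminorm_smul_le [StarModule C(X, ℂ) A] (g : C(X, ℂ)) (z : Matrix k l V) :
    traceSeminorm V k l (g • z) ≤ ‖g‖ * traceSeminorm V k l z := by
  refine le_of_forall_pos_le_add fun ε hε => ?_
  have hg : 0 < ‖g‖ + 1 := by positivity
  obtain ⟨m, n, _, _, ξ, η, w, hξ, hη, hw, rfl⟩ := exists_sandwich_of_traceSeminorm_lt V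
    (lt_add_of_pos_right (traceSeminorm V k l z) (div_pos hε hg))
  rw [← sandwich_smul]
  refine (traceSeminorm_sandwich_le V one_pos hξ hη _).trans ?_
  rw [one_mul]
  refine (matSeminorm_smul_le V g w).trans ?_
  refine (mul_le_mul_of_nonneg_left hw.le (norm_nonneg g)).trans ?_
  rw [mul_add]
  gcongr
  rw [mul_div_assoc', div_le_iff₀ hg]
  nlinarith

/-- The local seminorms of the operator space projective tensor norm are lower semicontinuous. -/
lemma lowerSemicontinuous_localSeminorm_traceSeminorm [StarModule C(X, ℂ) A]
    (hA : IsContinuousField X A) (z : Matrix k l V) :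
    LowerSemicontinuous fun y : X =>
      localSeminorm (traceSeminorm V k l) (traceSeminorm_smul_le V) y z := by
  classical
  intro y₀ r hr
  rcases lt_or_ge r 0 with hr0 | hr0
  · exact Eventually.of_forall fun y => hr0.trans_le (apply_nonneg _ _)
  obtain ⟨ε, hε, hεr⟩ : ∃ ε : ℝ, 0 < ε ∧ (1 + ε) * (r + 3 * ε) <
      localSeminorm (traceSeminorm V k l) (traceSeminorm_smul_le V) y₀ z := by
    have h1 : Tendsto (fun ε : ℝ => (1 + ε) * (r + 3 * ε)) (𝓝[>] 0)
        (𝓝 ((1 + 0) * (r + 3 * 0))) :=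
      (Continuous.tendsto (by fun_prop) 0).mono_left nhdsWithin_le_nhds
    simp only [add_zero, one_mul, mul_zero] at h1
    obtain ⟨ε, h2, h3⟩ := ((h1.eventually_lt_const hr).and self_mem_nhdsWithin).exists
    exact ⟨ε, h3, h2⟩
  set d : ℝ := Fintype.card k + Fintype.card l + 1
  have hd : 0 < d := by positivity
  set δ : ℝ := ε / d
  have hδ : 0 < δ := by positivity
  -- A finite family, independent of `y`, whose span contains every compression of `z` by square
  -- scalar matrices.
  let b (t : (k × l) × (k × l)) : Matrix k l V := Matrix.single t.1.1 t.1.2 (z t.2.1 t.2.2)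
  have hsum (α : Matrix k k ℂ) (β : Matrix l l ℂ) : sandwich α β z =
      ∑ t, (star (α t.2.1 t.1.1) * β t.2.2 t.1.2) • b t := by
    ext i j : 2
    rw [sandwich_apply, Matrix.sum_apply, Fintype.sum_prod_type, Finset.sum_eq_single (i, j)]
    · rw [Fintype.sum_prod_type]
      simp [b]
    · rintro ⟨i', j'⟩ - hne
      refine Finset.sum_eq_zero fun t _ => ?_
      have h : ¬(i' = i ∧ j' = j) := fun h => hne (Prod.ext h.1 h.2)
      simp [b, h]
    · simp
  -- The coefficients below are at most `δ⁻¹`, so tolerance `ε * δ` costs at most `ε`.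
  filter_upwards [eventually_seminorm_sum_le (fun y z => localSeminorm_le z)
    (lowerSemicontinuous_localSeminorm_matSeminorm V hA) y₀ b (mul_pos hε hδ)] with y hy
  by_contra! hcon
  obtain ⟨g, hg, hgz⟩ := exists_lt_of_localSeminorm_lt (hcon.trans_lt (lt_add_of_pos_right r hε))
  obtain ⟨m, n, _, _, ξ, η, w, hξ, hη, hw, hz⟩ := exists_sandwich_of_traceSeminorm_lt V hgz
  obtain ⟨α, α', D, hα2, hαD, hαhs, hαb⟩ := exists_contraction_mul_eq ξ hδ
  obtain ⟨β, β', D', hβ2, hβD, hβhs, hβb⟩ := exists_contraction_mul_eq η hδ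
  have h1 : localSeminorm (matSeminorm V k l) (matSeminorm_smul_le V) y (sandwich α' β' z) <
      r + ε := by
    refine (localSeminorm_le_smul hg _).trans_lt ?_
    rw [← sandwich_smul, hz, sandwich_sandwich]
    exact (matSeminorm_sandwich_le V _ D hαD _ D' hβD w).trans_lt hw
  have h2 : localSeminorm (matSeminorm V k l) (matSeminorm_smul_le V) y₀ (sandwich α' β' z) <
      r + 3 * ε := by
    have h3 := hy fun t => star (α' t.2.1 t.1.1) * β' t.2.2 t.1.2
    rw [← hsum] at h3
    have h4 : ‖fun t : (k × l) × (k × l) => star (α' t.2.1 t.1.1) * β' t.2.2 t.1.2‖ ≤ δ⁻¹ := by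
      refine (pi_norm_le_iff_of_nonneg (by positivity)).2 fun t => ?_
      rw [norm_mul, norm_star]
      nlinarith [hαb t.2.1 t.1.1, hβb t.2.2 t.1.2,
        sq_nonneg (‖α' t.2.1 t.1.1‖ - ‖β' t.2.2 t.1.2‖)]
    have h5 := mul_le_mul_of_nonneg_left h4 (mul_pos hε hδ).le
    rw [mul_inv_cancel_right₀ hδ.ne'] at h5
    linarith
  obtain ⟨h, hh, hhz⟩ := exists_lt_of_localSeminorm_lt h2
  -- Undoing the compression gives a factorization at `y₀` with Hilbert-Schmidt cost at most `1 +
  -- ε`, contradicting the choice of `ε`.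
  have h6 : h • z = sandwich α β (h • sandwich α' β' z) := by
    rw [sandwich_smul, sandwich_sandwich, hα2, hβ2, sandwich_one]
  have hδd (N : ℝ) (hN : N ≤ d) : δ * N ≤ ε := by
    calc δ * N ≤ δ * d := by gcongr
      _ = ε := div_mul_cancel₀ _ hd.ne'
  have h7 : traceSeminorm V k l (h • z) ≤ (1 + ε) * (r + 3 * ε) := by
    rw [h6]
    refine (traceSeminorm_sandwich_le V (c := 1 + ε) (by positivity) ?_ ?_ _).trans ?_
    · rw [hαhs]
      exact add_le_add hξ (hδd _ (by
        simp only [d]; linarith [(Fintype.card l).cast_nonneg (α := ℝ)]))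
    · rw [hβhs]
      exact add_le_add hη (hδd _ (by
        simp only [d]; linarith [(Fintype.card k).cast_nonneg (α := ℝ)]))
    · gcongr
  exact absurd ((localSeminorm_le_smul hh z).trans h7) (not_le.2 hεr)

end TraceGauge

/-! ### Block norms as suprema of bilinear forms -/

section BlockNorms

variable {m n : Type*} [Fintype m] [Fintype n]

lemma mul_star_eq_norm_sq (c : ℂ) : c * star c = ((‖c‖ ^ 2 : ℝ) : ℂ) := by
  rw [Complex.star_def, Complex.mul_conj']
  norm_cast

lemma norm_sum_mul_mul_le_norm (M : Matrix m n ℂ) (ξ : m → ℂ) (η : n → ℂ)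
    (hξ : ∑ a, ‖ξ a‖ ^ 2 ≤ 1) (hη : ∑ b, ‖η b‖ ^ 2 ≤ 1) :
    ‖∑ a, ∑ b, ξ a * M a b * η b‖ ≤ ‖CStarMatrix.ofMatrix M‖ := by
  let v : C⋆ᵐᵒᵈ(ℂ, m → ℂ) := (WithCStarModule.equiv ℂ _).symm ξ
  let w : C⋆ᵐᵒᵈ(ℂ, n → ℂ) := (WithCStarModule.equiv ℂ _).symm fun b => star (η b)
  have hv : ‖v‖ ≤ 1 := by
    refine le_of_sq_le_sq ?_ zero_le_one
    rw [WithCStarModule.pi_norm_sq, one_pow]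
    refine le_of_eq_of_le ?_ hξ
    simp only [WithCStarModule.inner_def]
    change ‖∑ a, ξ a * star (ξ a)‖ = _
    simp only [mul_star_eq_norm_sq, ← Complex.ofReal_sum, Complex.norm_real]
    exact Real.norm_of_nonneg (by positivity)
  have hw : ‖w‖ ≤ 1 := by
    refine le_of_sq_le_sq ?_ zero_le_one
    rw [WithCStarModule.pi_norm_sq, one_pow]
    refine le_of_eq_of_le ?_ hη
    simp only [WithCStarModule.inner_def]
    change ‖∑ b, star (η b) * star (star (η b))‖ = _
    simp only [mul_star_eq_norm_sq, norm_star, ← Complex.ofReal_sum, Complex.norm_real]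
    exact Real.norm_of_nonneg (by positivity)
  have hinner : ⟪w, CStarMatrix.toCLM (CStarMatrix.ofMatrix M) v⟫_ℂ =
      ∑ a, ∑ b, ξ a * M a b * η b := by
    rw [WithCStarModule.pi_inner, Finset.sum_comm]
    simp only [WithCStarModule.inner_def, CStarMatrix.toCLM_apply_eq_sum]
    refine Finset.sum_congr rfl fun b _ => ?_
    change (∑ a, ξ a * M a b) * star (star (η b)) = _
    rw [star_star, Finset.sum_mul]
  rw [← hinner]
  calc _ ≤ ‖w‖ * ‖CStarMatrix.toCLM (CStarMatrix.ofMatrix M) v‖ :=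
        CStarModule.norm_inner_le (C⋆ᵐᵒᵈ(ℂ, n → ℂ))
    _ ≤ 1 * (‖CStarMatrix.ofMatrix M‖ * 1) := by
        gcongr
        exact (ContinuousLinearMap.le_opNorm _ _).trans
          (mul_le_mul_of_nonneg_left hv (norm_nonneg _))
    _ = _ := by ring

lemma sum_sq_norm_apply_le {X : Type*} [TopologicalSpace X] [CompactSpace X]
    (u : C⋆ᵐᵒᵈ(C(X, ℂ), m → C(X, ℂ))) (y : X) : ∑ a, ‖u a y‖ ^ 2 ≤ ‖u‖ ^ 2 := by
  rw [WithCStarModule.pi_norm_sq]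
  refine le_trans (le_of_eq ?_) (ContinuousMap.norm_coe_le_norm _ y)
  simp only [WithCStarModule.inner_def, ContinuousMap.sum_apply]
  change _ = ‖∑ a, u a y * star (u a y)‖
  simp only [mul_star_eq_norm_sq, ← Complex.ofReal_sum, Complex.norm_real]
  exact (Real.norm_of_nonneg (by positivity)).symm

/-- The norm over `C(X)` can be tested pointwise: vectors over `C(X)`, once normalized, evaluate
into the scalar unit balls. -/
lemma cstarMatrix_continuousMap_norm_le {X : Type*} [TopologicalSpace X] [CompactSpace X]
    (M : Matrix m n C(X, ℂ)) {r : ℝ} (hr : 0 ≤ r)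
    (h : ∀ (y : X) (ξ : m → ℂ) (η : n → ℂ), ∑ a, ‖ξ a‖ ^ 2 ≤ 1 → ∑ b, ‖η b‖ ^ 2 ≤ 1 →
      ‖∑ a, ∑ b, ξ a * M a b y * η b‖ ≤ r) :
    ‖CStarMatrix.ofMatrix M‖ ≤ r := by
  refine CStarMatrix.norm_le_of_forall_inner_le (C := ⟨r, hr⟩) fun v w => ?_
  change _ ≤ r * _ * _
  rcases eq_or_ne v 0 with rfl | hv
  · simp
  rcases eq_or_ne w 0 with rfl | hw
  · simp
  have hv0 : 0 < ‖v‖ := norm_pos_iff.2 hv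
  have hw0 : 0 < ‖w‖ := norm_pos_iff.2 hw
  rw [ContinuousMap.norm_le _ (by positivity)]
  intro y
  have hinner : ⟪w, CStarMatrix.toCLM (CStarMatrix.ofMatrix M) v⟫_C(X, ℂ) y =
      ∑ a, ∑ b, v a y * M a b y * star (w b y) := by
    rw [WithCStarModule.pi_inner, Finset.sum_comm]
    simp only [WithCStarModule.inner_def, CStarMatrix.toCLM_apply_eq_sum, ContinuousMap.sum_apply]
    refine Finset.sum_congr rfl fun b _ => ?_
    change (∑ a, v a * M a b) y * star (w b y) = _
    rw [ContinuousMap.sum_apply, Finset.sum_mul]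
    rfl
  have hscale := h y (fun a => ((‖v‖⁻¹ : ℝ) : ℂ) * v a y)
    (fun b => ((‖w‖⁻¹ : ℝ) : ℂ) * star (w b y))
    (by
      simp only [norm_mul, mul_pow, Complex.norm_real, norm_inv, norm_norm, ← Finset.mul_sum]
      rw [inv_pow, inv_mul_le_iff₀ (by positivity), mul_one]
      exact sum_sq_norm_apply_le v y)
    (by
      simp only [norm_mul, mul_pow, Complex.norm_real, norm_inv, norm_norm, ← Finset.mul_sum,
        norm_star]
      rw [inv_pow, inv_mul_le_iff₀ (by positivity), mul_one]
      exact sum_sq_norm_apply_le w y)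
  have hfactor : ∑ a, ∑ b, ((‖v‖⁻¹ : ℝ) : ℂ) * v a y * M a b y *
      (((‖w‖⁻¹ : ℝ) : ℂ) * star (w b y)) =
      ((‖v‖⁻¹ * ‖w‖⁻¹ : ℝ) : ℂ) * ∑ a, ∑ b, v a y * M a b y * star (w b y) := by
    simp only [Finset.mul_sum]
    refine Finset.sum_congr rfl fun a _ => Finset.sum_congr rfl fun b _ => ?_
    push_cast
    ring
  rw [hfactor, norm_mul, Complex.norm_real, Real.norm_of_nonneg (by positivity), ← mul_inv,
    inv_mul_le_iff₀ (by positivity)] at hscale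
  rw [hinner]
  linarith

end BlockNorms

/-! ### Duality, separability and padding -/

section Assembly

variable {X : Type*} [TopologicalSpace X] [CompactSpace X]
variable {A : Type*} [CStarAlgebra A] [Algebra C(X, ℂ) A] [IsScalarTower ℂ C(X, ℂ) A]
  (V : Submodule C(X, ℂ) A)

/-- The duality formula: `ξ` and `η`, read as vectors indexed by pairs, pair with the amplification
of the map whose entries are `G (Matrix.single i j ·)`. Their Hilbert-Schmidt norms become Euclidean
norms. -/
lemma dual_sandwich {m n k l W : Type*} [Fintype m] [Fintype n] [Fintype k] [Fintype l]
    [DecidableEq k] [DecidableEq l] [AddCommGroup W] [Module ℂ W]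
    (G : Matrix k l W →ₗ[ℂ] ℂ) (ξ : Matrix m k ℂ) (η : Matrix n l ℂ) (w : Matrix m n W) :
    G (sandwich ξ η w) = ∑ s : m × k, ∑ t : n × l,
      star (ξ s.1 s.2) * G (Matrix.single s.2 t.2 (w s.1 t.1)) * η t.1 t.2 := by
  have h : sandwich ξ η w = ∑ s : m × k, ∑ t : n × l,
      (star (ξ s.1 s.2) * η t.1 t.2) • Matrix.single s.2 t.2 (w s.1 t.1) := by
    ext i j
    simp only [Fintype.sum_prod_type, sandwich_apply, Matrix.sum_apply, Matrix.smul_apply,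
      Matrix.single_apply, ite_and, smul_ite, smul_zero]
    refine Finset.sum_congr rfl fun a _ => ?_
    rw [Finset.sum_eq_single i]
    · simp
    · intro i' _ hi'
      simp [hi']
    · simp
  rw [h]
  simp only [map_sum, map_smul, smul_eq_mul]
  refine Finset.sum_congr rfl fun s _ => Finset.sum_congr rfl fun t _ => ?_
  ring

variable [PartialOrder A] [StarOrderedRing A]

lemma exists_dense_seq_traceSeminorm [TopologicalSpace.SeparableSpace A] (k l : Type) [Fintype k]
    [Fintype l] :
    ∃ b : ℕ → Matrix k l V, ∀ z, ∀ ε > 0, ∃ i, traceSeminorm V k l (z - b i) < ε := by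
  classical
  have : SecondCountableTopology A := UniformSpace.secondCountable_of_separable A
  set c : ℝ := max (hsNormSq (1 : Matrix k k ℂ)) (hsNormSq (1 : Matrix l l ℂ)) + 1
  have hc : 0 < c := by
    have := (hsNormSq_nonneg (1 : Matrix k k ℂ)).trans (le_max_left _ (hsNormSq (1 : Matrix l l ℂ)))
    positivity
  have hle (z : Matrix k l V) : traceSeminorm V k l z ≤ c * ∑ i, ∑ j, ‖z i j‖ := by
    have h := traceSeminorm_sandwich_le V (ξ := (1 : Matrix k k ℂ)) (η := (1 : Matrix l l ℂ)) hc
      ((le_max_left _ _).trans (lt_add_one _).le) ((le_max_right _ _).trans (lt_add_one _).le) z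
    rw [sandwich_one] at h
    exact h.trans (mul_le_mul_of_nonneg_left (matSeminorm_le_sum V z) hc.le)
  refine ⟨fun i => Matrix.of (TopologicalSpace.denseSeq (k → l → V) i), fun z ε hε => ?_⟩
  have hopen : IsOpen {b : k → l → V | c * ∑ i, ∑ j, ‖z i j - b i j‖ < ε} :=
    isOpen_lt (by fun_prop) continuous_const
  obtain ⟨i, hi⟩ := (TopologicalSpace.denseRange_denseSeq (k → l → V)).exists_mem_open hopen
    ⟨z, by change c * ∑ i, ∑ j, ‖z i j - z i j‖ < ε; simpa using hε⟩
  exact ⟨i, (hle _).trans_lt hi⟩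

/-- A matrix can be padded to a square one. -/
lemma exists_square_sandwich {m n k l : Type} [Fintype m] [Fintype n] [Fintype k] [Fintype l]
    (ξ : Matrix m k ℂ) (η : Matrix n l ℂ) (w : Matrix m n V) :
    ∃ (N : ℕ) (ξ' : Matrix (Fin N) k ℂ) (η' : Matrix (Fin N) l ℂ)
      (w' : Matrix (Fin N) (Fin N) V), hsNormSq ξ' = hsNormSq ξ ∧ hsNormSq η' = hsNormSq η ∧
        matSeminorm V _ _ w' ≤ matSeminorm V _ _ w ∧ sandwich ξ' η' w' = sandwich ξ η w := by
  classical
  let e : m ⊕ n ≃ Fin (Fintype.card (m ⊕ n)) := Fintype.equivFin _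
  -- `a` and `b` are the coordinate projections of the direct sum; each is the complement that shows
  -- the other to be a contraction. Squareness is needed because complete contractivity tests only
  -- square matrices.
  let a : Matrix m (Fin (Fintype.card (m ⊕ n))) ℂ :=
    Matrix.of fun i j => if Sum.inl i = e.symm j then 1 else 0
  let b : Matrix n (Fin (Fintype.card (m ⊕ n))) ℂ :=
    Matrix.of fun i j => if Sum.inr i = e.symm j then 1 else 0
  have hab : aᴴ * a + bᴴ * b = 1 := by
    ext i j
    obtain ⟨s, rfl⟩ := e.surjective i
    obtain ⟨t, rfl⟩ := e.surjective j
    rcases s with s | s <;> rcases t with t | t <;>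
      simp [a, b, Matrix.mul_apply, Matrix.one_apply, apply_ite star, eq_comm]
  have ha : a * aᴴ = 1 := by
    ext i j
    rw [Matrix.mul_apply, ← e.sum_comp]
    simp [a, Matrix.one_apply, eq_comm]
  have hb : b * bᴴ = 1 := by
    ext i j
    rw [Matrix.mul_apply, ← e.sum_comp]
    simp [b, Matrix.one_apply, eq_comm]
  have hs {m₁ k₁ o₁ : Type} [Fintype m₁] [Fintype k₁] [Fintype o₁] [DecidableEq m₁]
      (c : Matrix m₁ o₁ ℂ) (hc : c * cᴴ = 1)
      (ξ : Matrix m₁ k₁ ℂ) : hsNormSq (cᴴ * ξ) = hsNormSq ξ := by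
    have h1 : (cᴴ * ξ)ᴴ * (cᴴ * ξ) = ξᴴ * ξ := by
      rw [Matrix.conjTranspose_mul, Matrix.conjTranspose_conjTranspose, Matrix.mul_assoc,
        ← Matrix.mul_assoc c, hc, Matrix.one_mul]
    have h2 := congrArg Matrix.trace h1
    rw [trace_conjTranspose_mul_self, trace_conjTranspose_mul_self] at h2
    exact_mod_cast h2
  refine ⟨_, aᴴ * ξ, bᴴ * η, sandwich a b w, hs a ha ξ, hs b hb η,
    matSeminorm_sandwich_le V a b hab b a (by rw [add_comm, hab]) w, ?_⟩
  rw [sandwich_sandwich, ← Matrix.mul_assoc, ← Matrix.mul_assoc, ha, hb, Matrix.one_mul,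
    Matrix.one_mul]

end Assembly

end CXWittstock

end

/-! ### The extension theorem -/

theorem corollary2p7 {X : Type*} [TopologicalSpace X] [CompactSpace X] [T2Space X]
    {A : Type*} [CStarAlgebra A] [PartialOrder A] [StarOrderedRing A]
    [TopologicalSpace.SeparableSpace A]
    [Algebra C(X, ℂ) A] [IsScalarTower ℂ C(X, ℂ) A] [StarModule C(X, ℂ) A]
    (hA : IsContinuousField X A) (V : Submodule C(X, ℂ) A) (x : X) (k l : ℕ)
    (φ : Fibre V x →ₗ[ℂ] Matrix (Fin k) (Fin l) ℂ)
    (hφ : IsCompletelyContractive (fibreNorm V x) (blockNorm ℂ k l) φ) :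
    ∃ Φ : V →ₗ[C(X, ℂ)] Matrix (Fin k) (Fin l) C(X, ℂ),
      IsCompletelyContractive (subNorm V) (blockNorm C(X, ℂ) k l) Φ ∧
        ∀ v : V, (Φ v).map (fun f => f x) = φ (toFibre x v) := by
  let F : Module.Dual ℂ (Matrix (Fin k) (Fin l) V) :=
    { toFun := fun z => ∑ i, ∑ j, φ (toFibre x (z i j)) i j
      map_add' := fun z w => by
        simp only [← Finset.sum_add_distrib]
        refine Finset.sum_congr rfl fun i _ => Finset.sum_congr rfl fun j _ => ?_
        exact congrFun (congrFun (map_add φ (toFibre x (z i j)) (toFibre x (w i j))) i) j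
      map_smul' := fun c z => by
        simp only [RingHom.id_apply, Finset.smul_sum]
        refine Finset.sum_congr rfl fun i _ => Finset.sum_congr rfl fun j _ => ?_
        exact congrFun (congrFun (map_smul φ c (toFibre x (z i j))) i) j }
  have hFdef (z : Matrix (Fin k) (Fin l) V) : F z = ∑ i, ∑ j, φ (toFibre x (z i j)) i j := rfl
  have hFsingle (i : Fin k) (j : Fin l) (v : V) :
      F (Matrix.single i j v) = φ (toFibre x v) i j := by
    have h0 : toFibre x (0 : V) = 0 := rfl
    rw [hFdef, Finset.sum_eq_single i, Finset.sum_eq_single j]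
    · simp
    · intro j' _ hj'
      simp [hj'.symm, h0]
    · simp
    · intro i' _ hi'
      simp [hi'.symm, h0]
    · simp
  have hFsquare {N : ℕ} (ξ : Matrix (Fin N) (Fin k) ℂ) (η : Matrix (Fin N) (Fin l) ℂ)
      (w : Matrix (Fin N) (Fin N) V) (hξ : hsNormSq ξ ≤ 1) (hη : hsNormSq η ≤ 1) :
      ‖F (sandwich ξ η w)‖ ≤ matSeminorm V _ _ w := by
    rw [dual_sandwich]
    simp only [hFsingle]
    calc _ ≤ blockNorm ℂ k l N ((w.map (toFibre x)).map φ) :=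
          norm_sum_mul_mul_le_norm
            (Matrix.comp (Fin N) (Fin N) (Fin k) (Fin l) ℂ ((w.map (toFibre x)).map φ))
            (fun s => star (ξ s.1 s.2)) (fun t => η t.1 t.2)
            (by simpa only [hsNormSq, norm_star, Fintype.sum_prod_type] using hξ)
            (by simpa only [hsNormSq, Fintype.sum_prod_type] using hη)
      _ ≤ fibreNorm V x N (w.map (toFibre x)) := hφ N _
      _ ≤ subNorm V N w :=
          csInf_le ⟨0, by rintro _ ⟨v, -, rfl⟩; exact norm_nonneg _⟩ ⟨w, rfl, rfl⟩
  have hFtrace (z : Matrix (Fin k) (Fin l) V) : ‖F z‖ ≤ traceSeminorm V (Fin k) (Fin l) z := by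
    refine le_of_forall_gt fun r hr => ?_
    obtain ⟨m, n, _, _, ξ, η, w, hξ, hη, hw, rfl⟩ := exists_sandwich_of_traceSeminorm_lt V hr
    obtain ⟨N, ξ', η', w', hξ', hη', hw', heq⟩ := exists_square_sandwich V ξ η w
    rw [← heq]
    exact (hFsquare ξ' η' w' (hξ'.trans_le hξ) (hη'.trans_le hη)).trans_lt (hw'.trans_lt hw)
  -- `F` factors through the fibre at `x`, so multiplying by a peak function does not change its
  -- value.
  have hF (z : Matrix (Fin k) (Fin l) V) : ‖F z‖ ≤ localSeminorm
      (traceSeminorm V (Fin k) (Fin l)) (traceSeminorm_smul_le V) x z := by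
    refine le_localSeminorm fun g hg => ?_
    have h : F z = F (g • z) := by
      simp only [hFdef, Matrix.smul_apply, toFibre_smul hg.2]
    rw [h]
    exact hFtrace _
  obtain ⟨Φ₀, hΦ₀, hΦ₀x⟩ := exists_linearMap_extending_dual
    (traceSeminorm V (Fin k) (Fin l)) (traceSeminorm_smul_le V)
    (lowerSemicontinuous_localSeminorm_traceSeminorm V hA)
    (exists_dense_seq_traceSeminorm V (Fin k) (Fin l)) x F hF
  refine ⟨{ toFun := fun v => Matrix.of fun i j => Φ₀ (Matrix.single i j v)
            map_add' := fun v w => by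
              ext i j : 2
              simp [Matrix.single_add]
            map_smul' := fun g v => by
              ext i j : 2
              simp [← Matrix.smul_single] }, fun n w => ?_, fun v => ?_⟩
  -- The duality in reverse: unit vectors are read as matrices in the Hilbert-Schmidt unit balls.
  -- `ξ` is conjugated because `sandwich` conjugates its left factor.
  · refine cstarMatrix_continuousMap_norm_le _ (norm_nonneg _) fun y ξ η hξ hη => ?_
    let G : Matrix (Fin k) (Fin l) V →ₗ[ℂ] ℂ :=
      (ContinuousMap.evalAlgHom ℂ ℂ y).toLinearMap ∘ₗ Φ₀.restrictScalars ℂ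
    have hG := dual_sandwich G (Matrix.of fun (a : Fin n) i => star (ξ (a, i)))
      (Matrix.of fun (b : Fin n) j => η (b, j)) w
    simp only [Matrix.of_apply, star_star] at hG
    refine le_of_eq_of_le (congrArg norm hG.symm) ((hΦ₀ _ y).trans ?_)
    refine (traceSeminorm_sandwich_le V one_pos ?_ ?_ w).trans (le_of_eq (one_mul _))
    · simpa only [hsNormSq, Matrix.of_apply, norm_star, Fintype.sum_prod_type] using hξ
    · simpa only [hsNormSq, Matrix.of_apply, Fintype.sum_prod_type] using hη
  · ext i j
    exact (hΦ₀x _).trans (hFsingle i j v)
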